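/- Let $Q=(Q_0,Q_1)$ be a finite quiver, $k=\mathbb F_q$ a finite field, and $W=\sum_u a_u u$ a potential, i.e. a finite $k$-linear combination of cycles (closed paths of positive length) of $Q$. Assume that there is a weight function $\mathrm{wt}:Q_1\to\mathbb N$ that is positive on all cycles of $Q$ and takes one and the same value on all cycles with nonzero coefficient in $W$. Let $Q_2$ be the set of these cycles, and let $\Lambda$ be the pushout of $\mathbb Z^{Q_1}\leftarrow\mathbb Z^{Q_2}\to\mathbb Z$, where the first map sends a cycle to its content and the second sends every cycle to $1$; assume that the canonical map $\omega:\mathbb Z\to\Lambda$ is a split monomorphism. Let $\chi(\alpha,\beta)=\sum_{i\in Q_0}\alpha_i\beta_i-\sum_{a:i\to j}\alpha_i\beta_j$, $\langle\alpha,\beta\rangle=\chi(\alpha,\beta)-\chi(\beta,\alpha)$ and $T(\alpha)=\chi(\alpha,\alpha)$. For $\theta\in\mathbb R^{Q_0}$ and $0\ne\alpha\in\mathbb N^{Q_0}$ put $\mu_\theta(\alpha)=\theta\cdot\alpha/\sum_i\alpha_i$. A representation $M$ of $Q$ over $k$ is $\theta$-semistable if $\mu_\theta(\underline{\dim}\,N)\le\mu_\theta(\underline{\dim}\,M)$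 for all subrepresentations $0\ne N\subsetneq M$; put $w(M)=\sum_u a_u\operatorname{tr}(M_u)$, where $M_u$ is the composition of the maps of $M$ along $u$. For a formal combination $f=\sum a_M[M]$ of isomorphism classes of representations over $k$ let $f_0=\sum_{w(M)=0}a_M[M]$, $$I(f)=\sum a_M\,\frac{(-q^{1/2})^{T(\underline{\dim}\,M)}}{\#\operatorname{Aut}M}\,x^{\underline{\dim}\,M},\qquad I_{\rm eq}(f)=\frac{I(f)-q\,I(f_0)}{1-q},$$ and define the number $A^\theta_\alpha$ by $A^\theta_\alpha x^\alpha=I_{\rm eq}\bigl(\sum[M]\bigr)$, the sum being over the isomorphism classes of $\theta$-semistable representations $M$ with $\underline{\dim}\,M=\alpha$. Let $A_\alpha=A^{0}_\alpha$ be the invariant for $\theta=0$ (for which every representation is semistable). **Theorem.** For every $\theta\in\mathbb R^{Q_0}$ and every $\alpha\in\mathbb N^{Q_0}\setminus\{0\}$, $$A^\theta_\alpha=\sum_{(\alpha_1,\dots,\alpha_m)}(-1)^{m-1}\,(-q^{1/2})^{\sum_{i<j}\langle\alpha_i,\alpha_j\rangle}\prod_{i=1}^m A_{\alpha_i},$$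 where the (finite) sum runs over all $m\ge1$ and all tuples of vectors $\alpha_i\in\mathbb N^{Q_0}\setminus\{0\}$ such that $\sum_{i=1}^m\alpha_i=\alpha$ and $\mu_\theta\bigl(\sum_{i=1}^j\alpha_i\bigr)>\mu_\theta(\alpha)$ for all $1\le j<m$. -/

import Mathlib

open scoped Classical

namespace QuiverDT

noncomputable section

universe u v w

/-! ### Bilinear forms and slopes -/

/-- The Euler-Ringel form `χ(α, β) = ∑ᵢ αᵢ βᵢ - ∑_{a : i → j} αᵢ βⱼ`. -/
def eulerForm {V : Type u} [Quiver.{v} V] [Fintype V] [∀ i j : V, Fintype (i ⟶ j)]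
    (α β : V → ℤ) : ℤ :=
  ∑ i, α i * β i - ∑ i, ∑ j, ∑ _a : (i ⟶ j), α i * β j

/-- The skew-symmetric form `⟨α, β⟩ = χ(α, β) - χ(β, α)`. -/
def skewForm {V : Type u} [Quiver.{v} V] [Fintype V] [∀ i j : V, Fintype (i ⟶ j)]
    (α β : V → ℤ) : ℤ :=
  eulerForm α β - eulerForm β α

/-- The Tits form `T(α) = χ(α, α)`. -/
def titsForm {V : Type u} [Quiver.{v} V] [Fintype V] [∀ i j : V, Fintype (i ⟶ j)]
    (α : V → ℤ) : ℤ :=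
  eulerForm α α

/-- A dimension vector, seen in `ℤ^{Q₀}`. -/
def toInt {V : Type u} (α : V → ℕ) : V → ℤ := fun i => (α i : ℤ)

/-- The slope `μ_θ(α) = (θ · α) / ∑ᵢ αᵢ`; it is only used for `α ≠ 0`. -/
def slope {V : Type u} [Fintype V] (θ : V → ℝ) (α : V → ℕ) : ℝ :=
  (∑ i, θ i * (α i : ℝ)) / (∑ i, (α i : ℝ))

/-! ### Representations -/

/-- The space `R(Q, α)`: representations of the quiver on the vector spaces `k ^ αᵢ`.
Every representation of dimension vector `α` is isomorphic to one of these. -/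
abbrev Rep {V : Type u} [Quiver.{v} V] (k : Type w) [Field k] (α : V → ℕ) :=
  ∀ i j : V, (i ⟶ j) → ((Fin (α i) → k) →ₗ[k] (Fin (α j) → k))

section Representations

variable {V : Type u} [Quiver.{v} V] {k : Type w} [Field k] {α : V → ℕ}

/-- Isomorphisms of representations. -/
structure Rep.Iso (M N : Rep k α) where
  toEquiv : ∀ i : V, (Fin (α i) → k) ≃ₗ[k] (Fin (α i) → k)
  comm : ∀ (i j : V) (a : i ⟶ j) (x : Fin (α i) → k),
    toEquiv j (M i j a x) = N i j a (toEquiv i x)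

theorem Rep.Iso.ext' {M N : Rep k α} {f g : Rep.Iso M N} (h : f.toEquiv = g.toEquiv) :
    f = g := by
  cases f; cases g; cases h; rfl

/-- The identity isomorphism. -/
def Rep.Iso.refl (M : Rep k α) : Rep.Iso M M where
  toEquiv _ := LinearEquiv.refl k _
  comm _ _ _ _ := rfl

/-- The inverse isomorphism. -/
def Rep.Iso.symm {M N : Rep k α} (f : Rep.Iso M N) : Rep.Iso N M where
  toEquiv i := (f.toEquiv i).symm
  comm i j a x := by
    rw [LinearEquiv.symm_apply_eq, f.comm, LinearEquiv.apply_symm_apply]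

/-- Composition of isomorphisms. -/
def Rep.Iso.trans {M N P : Rep k α} (f : Rep.Iso M N) (g : Rep.Iso N P) : Rep.Iso M P where
  toEquiv i := (f.toEquiv i).trans (g.toEquiv i)
  comm i j a x := by
    simp only [LinearEquiv.trans_apply]
    rw [f.comm, g.comm]

/-- The number `# Aut M` of automorphisms of `M`. -/
def Rep.autCard (M : Rep k α) : ℕ := Nat.card (Rep.Iso M M)

/-- Subrepresentations of `M`. -/
structure Rep.Sub (M : Rep k α) where
  carrier : ∀ i : V, Submodule k (Fin (α i) → k)
  map_mem : ∀ (i j : V) (a : i ⟶ j), ∀ x : Fin (α i) → k,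
    x ∈ carrier i → M i j a x ∈ carrier j

/-- The dimension vector of a subrepresentation. -/
def Rep.Sub.dim {M : Rep k α} (N : M.Sub) : V → ℕ := fun i => Module.finrank k (N.carrier i)

/-- The representation `M` of dimension vector `α` is `θ`-semistable if `μ_θ(N) ≤ μ_θ(M)` for
every subrepresentation `0 ≠ N ⊊ M`. -/
def Rep.IsSemistable [Fintype V] (θ : V → ℝ) (M : Rep k α) : Prop :=
  ∀ N : M.Sub, (N.carrier ≠ fun _ => ⊥) → (N.carrier ≠ fun _ => ⊤) →
    slope θ N.dim ≤ slope θ α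

/-- The linear map `M_u` of a path `u`, the composition of the maps of its arrows. -/
def Rep.pathMap (M : Rep k α) {i : V} :
    ∀ {j : V}, Quiver.Path i j → ((Fin (α i) → k) →ₗ[k] (Fin (α j) → k))
  | _, Quiver.Path.nil => LinearMap.id
  | _, Quiver.Path.cons p a => (M _ _ a).comp (Rep.pathMap M p)

end Representations

/-! ### Potentials and weights -/

/-- Cycles of a quiver: closed paths of positive length. -/
structure CyclePath (V : Type u) [Quiver.{v} V] where
  base : V
  path : Quiver.Path base base
  length_pos : 0 < path.length

/-- Potentials `W = ∑ a_u u`: finite linear combinations of cycles. -/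
abbrev Potential (V : Type u) [Quiver.{v} V] (k : Type w) [Field k] := CyclePath V →₀ k

/-- The trace of the potential, `w(M) = ∑ a_u tr(M_u)`. -/
def Potential.trace {V : Type u} [Quiver.{v} V] {k : Type w} [Field k] (W : Potential V k)
    {α : V → ℕ} (M : Rep k α) : k :=
  W.sum fun u a => a * LinearMap.trace k (Fin (α u.base) → k) (M.pathMap u.path)

/-- The content of a cycle `u`: the element of `ℤ^{Q₁}` counting how often `u` passes through
each arrow. -/
def CyclePath.content {V : Type u} [Quiver.{v} V] (u : CyclePath V) : Quiver.Total V →₀ ℤ :=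
  u.path.addWeight fun {i j} (a : i ⟶ j) => Finsupp.single (⟨i, j, a⟩ : Quiver.Total V) (1 : ℤ)

/-- The weight `wt(u)` of a cycle. -/
def CyclePath.weight {V : Type u} [Quiver.{v} V] (wt : ∀ i j : V, (i ⟶ j) → ℕ)
    (u : CyclePath V) : ℕ :=
  u.path.addWeight fun {i j} (a : i ⟶ j) => wt i j a

/-- `W` is homogeneous with respect to `wt`: all cycles that occur in `W` have the same weight. -/
def Potential.IsHomogeneous {V : Type u} [Quiver.{v} V] {k : Type w} [Field k]
    (W : Potential V k) (wt : ∀ i j : V, (i ⟶ j) → ℕ) : Prop :=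
  ∃ d : ℕ, ∀ u ∈ W.support, u.weight wt = d

/-- The subgroup of `ℤ^{Q₁} × ℤ` generated by the elements `(content u, -1)`, where `u` runs
over the set `Q₂` of cycles that occur in `W`. -/
def Potential.relations {V : Type u} [Quiver.{v} V] {k : Type w} [Field k]
    (W : Potential V k) : AddSubgroup ((Quiver.Total V →₀ ℤ) × ℤ) :=
  AddSubgroup.closure {x | ∃ u ∈ W.support, x = (u.content, -1)}

/-- The group `Λ`: the pushout of `ℤ^{Q₁} ← ℤ^{Q₂} → ℤ`, where the first map sends a cycle to
its content and the second one sends every cycle to `1`. -/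
abbrev Potential.Lambda {V : Type u} [Quiver.{v} V] {k : Type w} [Field k]
    (W : Potential V k) := ((Quiver.Total V →₀ ℤ) × ℤ) ⧸ W.relations

/-- The canonical map `ω : ℤ → Λ`. -/
def Potential.omega {V : Type u} [Quiver.{v} V] {k : Type w} [Field k]
    (W : Potential V k) : ℤ →+ W.Lambda :=
  (QuotientAddGroup.mk' W.relations).comp (AddMonoidHom.inr (Quiver.Total V →₀ ℤ) ℤ)

/-- The primitivity condition: `ω : ℤ → Λ` is a split monomorphism. -/
def Potential.IsPrimitive {V : Type u} [Quiver.{v} V] {k : Type w} [Field k]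
    (W : Potential V k) : Prop :=
  ∃ s : W.Lambda →+ ℤ, s.comp W.omega = AddMonoidHom.id ℤ

/-! ### Isomorphism classes -/

section IsoClasses

variable {V : Type u} [Quiver.{v} V] {k : Type w} [Field k] {α : V → ℕ}

instance repSetoid (k : Type w) [Field k] (α : V → ℕ) : Setoid (Rep k α) where
  r M N := Nonempty (Rep.Iso M N)
  iseqv :=
    { refl := fun M => ⟨Rep.Iso.refl M⟩
      symm := fun ⟨f⟩ => ⟨f.symm⟩
      trans := fun ⟨f⟩ ⟨g⟩ => ⟨f.trans g⟩ }

/-- Isomorphism classes of representations of dimension vector `α`. -/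
def IsoClass (k : Type w) [Field k] (α : V → ℕ) := Quotient (repSetoid k α)

theorem autCard_congr {M N : Rep k α} (f : Rep.Iso M N) : M.autCard = N.autCard := by
  refine Nat.card_congr
    ⟨fun g => (f.symm.trans g).trans f, fun g => (f.trans g).trans f.symm, ?_, ?_⟩
  · intro g
    apply Rep.Iso.ext'
    funext i
    ext1 x
    simp [Rep.Iso.trans, Rep.Iso.symm]
  · intro g
    apply Rep.Iso.ext'
    funext i
    ext1 x
    simp [Rep.Iso.trans, Rep.Iso.symm]

theorem isSemistable_of_iso [Fintype V] (θ : V → ℝ) {M N : Rep k α} (f : Rep.Iso M N)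
    (hM : M.IsSemistable θ) : N.IsSemistable θ := by
  intro U hU hU'
  let U' : M.Sub :=
    { carrier := fun i => (U.carrier i).comap (f.toEquiv i).toLinearMap
      map_mem := fun i j a x hx => by
        simp only [Submodule.mem_comap, LinearEquiv.coe_coe] at hx ⊢
        rw [f.comm]
        exact U.map_mem i j a _ hx }
  have hc : ∀ i, U'.carrier i = (U.carrier i).comap (f.toEquiv i).toLinearMap := fun _ => rfl
  have hmap : ∀ i, (U'.carrier i).map (f.toEquiv i).toLinearMap = U.carrier i := fun i => by
    rw [hc, Submodule.map_comap_eq_of_surjective (f.toEquiv i).surjective]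
  have hd : U'.dim = U.dim := by
    funext i
    have h := LinearEquiv.finrank_map_eq (f.toEquiv i) (U'.carrier i)
    have h2 := hmap i
    unfold Rep.Sub.dim
    rw [← h]
    exact congrArg (fun P : Submodule k (Fin (α i) → k) => Module.finrank k P) h2
  rw [← hd]
  apply hM U'
  · intro h
    apply hU
    funext i
    rw [← hmap i, congrFun h i, Submodule.map_bot]
  · intro h
    apply hU'
    funext i
    rw [← hmap i, congrFun h i, Submodule.map_top, LinearMap.range_eq_top]
    exact (f.toEquiv i).surjective

theorem pathMap_comm {M N : Rep k α} (f : Rep.Iso M N) {i j : V} (p : Quiver.Path i j)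
    (x : Fin (α i) → k) : f.toEquiv j (M.pathMap p x) = N.pathMap p (f.toEquiv i x) := by
  induction p with
  | nil => rfl
  | cons p a ih =>
    simp only [Rep.pathMap, LinearMap.comp_apply]
    rw [f.comm, ih]

theorem trace_congr (W : Potential V k) {M N : Rep k α} (f : Rep.Iso M N) :
    W.trace M = W.trace N := by
  unfold Potential.trace
  refine Finset.sum_congr rfl fun u _ => congrArg (fun y => W u * y) ?_
  rw [← LinearMap.trace_conj' (M.pathMap u.path) (f.toEquiv u.base)]
  congr 1
  refine LinearMap.ext fun x => ?_
  rw [LinearEquiv.conj_apply_apply, pathMap_comm, LinearEquiv.apply_symm_apply]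

/-- `# Aut M`, as a function of the isomorphism class `[M]`. -/
def IsoClass.autCard (c : IsoClass k α) : ℕ :=
  Quotient.lift (s := repSetoid k α) Rep.autCard (fun _ _ h => h.elim autCard_congr) c

/-- Semistability, as a property of the isomorphism class `[M]`. -/
def IsoClass.IsSemistable [Fintype V] (θ : V → ℝ) (c : IsoClass k α) : Prop :=
  Quotient.lift (s := repSetoid k α) (Rep.IsSemistable θ)
    (fun _ _ h => h.elim fun f =>
      propext ⟨isSemistable_of_iso θ f, isSemistable_of_iso θ f.symm⟩) c

/-- The trace `w(M)` of the potential, as a function of the isomorphism class `[M]`. -/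
def IsoClass.trace (W : Potential V k) (c : IsoClass k α) : k :=
  Quotient.lift (s := repSetoid k α) W.trace (fun _ _ h => h.elim (trace_congr W)) c

instance isoClassFintype [Fintype V] [∀ i j : V, Fintype (i ⟶ j)] [Fintype k] :
    Fintype (IsoClass k α) :=
  haveI : ∀ i j : V, Finite ((Fin (α i) → k) →ₗ[k] (Fin (α j) → k)) := fun _ _ =>
    Finite.of_injective _ DFunLike.coe_injective
  haveI : Finite (Rep k α) := inferInstance
  haveI : Finite (IsoClass k α) := inferInstanceAs (Finite (Quotient (repSetoid k α)))
  Fintype.ofFinite _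

end IsoClasses

/-! ### The integration map and the invariants -/

/-- The underlying vector space of the completed Hall algebra: the formal (possibly infinite)
combinations `∑ a_M [M]` of isomorphism classes of representations. -/
abbrev HallHat (V : Type u) [Quiver.{v} V] (k : Type w) [Field k] :=
  ∀ α : V → ℕ, IsoClass k α → ℝ

/-- The underlying vector space of the quantum torus: the formal series `∑ c_α x^α`, given by
their coefficients. -/
abbrev QuantumTorus (V : Type u) := (V → ℕ) → ℝ

section Invariants

variable {V : Type u} [Quiver.{v} V] [Fintype V] [∀ i j : V, Fintype (i ⟶ j)]
  {k : Type w} [Field k] [Fintype k]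

/-- The number `-q^{1/2}`, where `q` is the number of elements of `k`. -/
def negSqrt (k : Type w) [Fintype k] : ℝ := -Real.sqrt (Fintype.card k : ℝ)

/-- The integration map `I`, with `I([M]) = (-q^{1/2})^{T(dim M)} / # Aut M · x^{dim M}`. -/
def intMap (f : HallHat V k) : QuantumTorus V := fun α =>
  ∑ c : IsoClass k α, f α c * (negSqrt k ^ titsForm (toInt α) / (c.autCard : ℝ))

/-- The part `f₀ = ∑_{w(M) = 0} a_M [M]` of `f = ∑ a_M [M]`. -/
def zeroPart (W : Potential V k) (f : HallHat V k) : HallHat V k := fun α c =>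
  if c.trace W = 0 then f α c else 0

/-- The equivariant integration map `I_eq(f) = (I(f) - q I(f₀)) / (1 - q)`. -/
def intEq (W : Potential V k) (f : HallHat V k) : QuantumTorus V := fun α =>
  (intMap f α - (Fintype.card k : ℝ) * intMap (zeroPart W f) α) / (1 - (Fintype.card k : ℝ))

/-- The element `Ã_α^θ`: the sum of all classes `[M]` with `M` a `θ`-semistable representation
of dimension vector `α`. -/
def ssElement (k : Type w) [Field k] (θ : V → ℝ) (α : V → ℕ) : HallHat V k := fun β c =>
  if β = α ∧ c.IsSemistable θ then 1 else 0

/-- The invariant `A_α^θ`, determined by `A_α^θ x^α = I_eq(Ã_α^θ)`. -/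
def dtInvariant (W : Potential V k) (θ : V → ℝ) (α : V → ℕ) : ℝ :=
  intEq W (ssElement k θ α) α

end Invariants

/-! ### The tuples in the formula -/

/-- Tuples `(α₁, …, α_m)` of nonzero dimension vectors, `m ≥ 1`, with sum `α`, such that
`μ_θ(α₁ + … + α_j) > μ_θ(α)` for all `1 ≤ j < m`. -/
def tuples {V : Type u} [Fintype V] (θ : V → ℝ) (α : V → ℕ) :
    Set (Σ m : ℕ, Fin m → (V → ℕ)) :=
  {t | 1 ≤ t.1 ∧ (∀ i, t.2 i ≠ 0) ∧ ∑ i, t.2 i = α ∧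
    ∀ j : ℕ, 1 ≤ j → j < t.1 →
      slope θ α < slope θ (∑ i ∈ Finset.univ.filter (fun i : Fin t.1 => i.val < j), t.2 i)}

theorem tuples_finite {V : Type u} [Fintype V] (θ : V → ℝ) (α : V → ℕ) :
    (tuples θ α).Finite := by
  have key : (⋃ m ∈ Set.Iic (∑ v, α v),
      (fun t => (⟨m, t⟩ : Σ m : ℕ, Fin m → (V → ℕ))) ''
        (Set.pi Set.univ fun _ => Set.Iic α)).Finite := by
    refine (Set.finite_Iic _).biUnion fun m _ => Set.Finite.image _ ?_
    exact Set.Finite.pi fun _ => Set.finite_Iic α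
  refine key.subset ?_
  rintro ⟨m, t⟩ ⟨_, h0, hs, _⟩
  simp only at h0 hs
  simp only [Set.mem_iUnion]
  refine ⟨m, ?_, t, ?_, rfl⟩
  · rw [Set.mem_Iic, ← hs]
    have h1 : ∀ i : Fin m, 1 ≤ ∑ v, t i v := fun i => by
      by_contra h
      apply h0 i
      have hz : ∑ v, t i v = 0 := by omega
      funext v
      exact Finset.sum_eq_zero_iff.mp hz v (Finset.mem_univ v)
    calc m = ∑ _i : Fin m, 1 := by simp
      _ ≤ ∑ i, ∑ v, t i v := Finset.sum_le_sum fun i _ => h1 i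
      _ = ∑ v, (∑ i, t i) v := by
        rw [Finset.sum_comm]
        simp [Finset.sum_apply]
  · intro i _
    rw [Set.mem_Iic, ← hs]
    exact Finset.single_le_sum (f := t) (fun _ _ => zero_le) (Finset.mem_univ i)

/-- The finite set of tuples over which the formula sums. -/
def tupleFinset {V : Type u} [Fintype V] (θ : V → ℝ) (α : V → ℕ) :
    Finset (Σ m : ℕ, Fin m → (V → ℕ)) :=
  (tuples_finite θ α).toFinset

end

end QuiverDT

/-! Three facts give the formula: a character-sum description of the invariants, a multiplicativity
property of these sums, and an identity writing the indicator of semistability as a signed count of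
chains of subrepresentations.

Character sums. Orbit counting (`sum_isoClass`) turns sums over isomorphism classes weighted by `1 /
# Aut` into sums over the space `R(Q, α)` divided by `# GL_α`. A splitting of `ω` gives integer
weights of the arrows such that rescaling them by powers of `t` multiplies `w` by `t`, without
changing the subrepresentations. Hence `∑ ψ(t w(M)) f(M)` is the same for all `t ≠ 0` when `f` is
invariant under rescaling. Summing over all `t`, for a primitive additive character `ψ`, identifies
`I_eq` with a normalised sum of `ψ(w(M))` (`dtInvariant_eq`).

Multiplicativity. A representation with a chosen subrepresentation is block triangular, and `w` is
the sum of the traces of the two diagonal blocks. So a sum over pairs `N ⊆ M` with prescribed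
dimension vectors factors into character sums for `N` and `M/N`; counting off-diagonal blocks and
group orders produces the power of `-q^{1/2}` given by the skew form (`normFactor_mul_charSum_sub`).

Chains. Call a subrepresentation positive if its `excess` is positive, i.e. its slope exceeds that
of `α`. The signed count of all chains of positive subrepresentations of `M`, the empty chain
included, is `1` if `M` is semistable and `0` otherwise (`sum_mob_lt_top`). In the unstable case,
joining with a subrepresentation `D` of maximal excess preserves positivity and forces cancellation;
no filtration of Harder-Narasimhan type is needed.

Integrating the chain count and peeling off the largest member of a chain gives a recursion
(`chainIntegral_of_ne_zero`). Unrolled, it is the sum over tuples: the partial sums of a tuple are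
the dimension vectors of the members of a chain, its entries those of the successive quotients
(`sum_tupleTerm`). -/

namespace QuiverDT

noncomputable section

/-! ### A Möbius function relative to a predicate -/

section Mobius

/-- The signed count of the chains `⊥ < x₁ < ⋯ < xₙ = x` whose elements other than `⊥` all
satisfy `P`. -/
def mob {X : Type*} [PartialOrder X] [OrderBot X] [Fintype X] (P : X → Prop) (x : X) : ℤ :=
  if x = ⊥ then 1 else if P x then -∑ y : {y // y < x}, mob P y.1 else 0
termination_by (wellFounded_lt (α := X)).wrap x
decreasing_by exact y.2

variable {X Y : Type*} [PartialOrder X] [OrderBot X] [Fintype X]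
  [PartialOrder Y] [OrderBot Y] [Fintype Y]

theorem mob_bot (P : X → Prop) : mob P ⊥ = 1 := by
  rw [mob, if_pos rfl]

theorem mob_of_not {P : X → Prop} {x : X} (hx : x ≠ ⊥) (h : ¬ P x) : mob P x = 0 := by
  rw [mob, if_neg hx, if_neg h]

theorem mob_of_pos {P : X → Prop} {x : X} (hx : x ≠ ⊥) (h : P x) :
    mob P x = -∑ y with y < x, mob P y := by
  rw [mob, if_neg hx, if_pos h, Finset.sum_subtype _ (p := fun y => y < x) (by simp)]

theorem sum_mob_le {P : X → Prop} {x : X} (hx : x ≠ ⊥) (h : P x) :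
    ∑ y with y ≤ x, mob P y = 0 := by
  have : (Finset.univ.filter (fun y => y ≤ x)) = insert x (Finset.univ.filter (fun y => y < x)) := by
    ext y
    simp [le_iff_eq_or_lt]
  rw [this, Finset.sum_insert (by simp), mob_of_pos hx h]
  ring

/-- The recursion for `mob` at a point only sees the elements below it, so an embedding onto a lower
set that respects the predicates preserves it. -/
theorem mob_embedding {P : X → Prop} {Q : Y → Prop} (e : X ↪o Y)
    (hlow : ∀ x y, y ≤ e x → ∃ x', e x' = y) (he : ∀ x, Q (e x) ↔ P x) (x : X) :
    mob Q (e x) = mob P x := by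
  have hbot : e ⊥ = ⊥ := by
    obtain ⟨x', hx'⟩ := hlow ⊥ ⊥ bot_le
    refine le_antisymm ?_ bot_le
    rw [← hx']
    exact e.monotone bot_le
  induction x using WellFoundedLT.induction with
  | ind x ih =>
    by_cases hx : x = ⊥
    · rw [hx, hbot, mob_bot, mob_bot]
    have hx' : e x ≠ ⊥ := fun h => hx (e.injective (h.trans hbot.symm))
    by_cases hp : P x
    · rw [mob_of_pos hx hp, mob_of_pos hx' ((he x).2 hp)]
      congr 1
      symm
      refine Finset.sum_bij (fun y _ => e y) ?_ ?_ ?_ ?_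
      · intro y hy
        simpa using hy
      · intro y _ z _ h
        exact e.injective h
      · intro y hy
        simp only [Finset.mem_filter, Finset.mem_univ, true_and] at hy
        obtain ⟨y', rfl⟩ := hlow x y hy.le
        exact ⟨y', by simpa using hy, rfl⟩
      · intro y hy
        exact (ih y (by simpa using hy)).symm
    · rw [mob_of_not hx hp, mob_of_not hx' (fun h => hp ((he x).1 h))]

/-- A Weisner-type cancellation: group the elements `x` that can contribute by the value `K` of `x ⊔
D`, and show that each group has sum zero. -/
theorem sum_mob_eq_zero {X : Type*} [SemilatticeSup X] [OrderBot X] [Fintype X] {P : X → Prop}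
    {D : X} (hD : P D) (hbot : D ≠ ⊥) (hsup : ∀ x, P x → P (x ⊔ D)) :
    ∑ x, mob P x = 0 := by
  let S : Finset X := Finset.univ.filter (fun x => x = ⊥ ∨ P x)
  have hS : ∀ x ∈ S, P (x ⊔ D) := by
    intro x hx
    rcases (Finset.mem_filter.1 hx).2 with h | h
    · simpa [h] using hD
    · exact hsup x h
  have hnot : ∀ x, x ∉ S → mob P x = 0 := by
    intro x hx
    simp only [S, Finset.mem_filter, Finset.mem_univ, true_and, not_or] at hx
    exact mob_of_not hx.1 hx.2
  -- Induction on `K`. A nonempty fibre forces `P K` and `D ≤ K`, so the values of `mob` on all `y ≤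
  -- K` sum to zero; as `y ≤ K` iff `y ⊔ D ≤ K`, this sum is the sum of the fibres over all `K' ≤
  -- K`, and those with `K' < K` already vanish.
  have key : ∀ K : X, ∑ x ∈ S with x ⊔ D = K, mob P x = 0 := by
    intro K
    induction K using WellFoundedLT.induction with
    | ind K ih =>
      by_cases hne : (S.filter (fun x => x ⊔ D = K)).Nonempty
      · obtain ⟨x, hx⟩ := hne
        rw [Finset.mem_filter] at hx
        have hPK : P K := hx.2 ▸ hS x hx.1
        have hDK : D ≤ K := hx.2 ▸ le_sup_right
        have hK : K ≠ ⊥ := fun h => hbot (le_bot_iff.1 (h ▸ hDK))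
        have h1 : ∑ y ∈ S with y ≤ K, mob P y = 0 := by
          rw [← sum_mob_le hK hPK]
          refine Finset.sum_subset (fun y hy => by simp_all) ?_
          intro y hy hy'
          refine hnot y fun h => hy' ?_
          simp_all
        have h2 : ∑ y ∈ S with y ≤ K, mob P y
            = ∑ K' with K' ≤ K, ∑ y ∈ S with y ⊔ D = K', mob P y := by
          rw [← Finset.sum_fiberwise_of_maps_to (s := S.filter (fun y => y ≤ K))
            (t := Finset.univ.filter (fun K' => K' ≤ K)) (g := fun y => y ⊔ D)]
          · refine Finset.sum_congr rfl fun K' hK' => ?_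
            refine Finset.sum_congr ?_ fun _ _ => rfl
            ext y
            simp only [Finset.mem_filter, Finset.mem_univ, true_and] at hK' ⊢
            constructor
            · rintro ⟨⟨a, b⟩, c⟩
              exact ⟨a, c⟩
            · rintro ⟨a, c⟩
              exact ⟨⟨a, le_sup_left.trans (c.le.trans hK')⟩, c⟩
          · intro y hy
            simp only [Finset.mem_filter, Finset.mem_univ, true_and] at hy ⊢
            exact sup_le hy.2 hDK
        rw [h1] at h2
        rw [Finset.sum_eq_single K] at h2
        · exact h2.symm
        · intro K' hK' hne
          exact ih K' (lt_of_le_of_ne (by simpa using hK') hne)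
        · simp
      · rw [Finset.not_nonempty_iff_eq_empty.1 hne, Finset.sum_empty]
  rw [← Finset.sum_subset (Finset.subset_univ S) (fun x _ hx => hnot x hx),
    ← Finset.sum_fiberwise S (fun x => x ⊔ D)]
  exact Finset.sum_eq_zero fun K _ => key K

end Mobius

/-! ### The lattice of subrepresentations -/

section SubLattice

variable {V : Type*} [Quiver V] {k : Type*} [Field k] {α β : V → ℕ}

theorem Rep.Sub.carrier_injective {M : Rep k α} :
    Function.Injective (Rep.Sub.carrier : M.Sub → _) := by
  rintro ⟨a, _⟩ ⟨b, _⟩ h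
  cases h
  rfl

instance (M : Rep k α) : Lattice M.Sub where
  __ := PartialOrder.lift (Rep.Sub.carrier : M.Sub → _) Rep.Sub.carrier_injective
  sup N N' :=
    { carrier := N.carrier ⊔ N'.carrier
      map_mem := fun i j a x hx => by
        obtain ⟨y, hy, z, hz, rfl⟩ := Submodule.mem_sup.1 hx
        rw [map_add]
        exact Submodule.add_mem_sup (N.map_mem i j a y hy) (N'.map_mem i j a z hz) }
  inf N N' :=
    { carrier := N.carrier ⊓ N'.carrier
      map_mem := fun i j a x hx => ⟨N.map_mem i j a x hx.1, N'.map_mem i j a x hx.2⟩ }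
  le_sup_left N N' := (le_sup_left : N.carrier ≤ N.carrier ⊔ N'.carrier)
  le_sup_right N N' := (le_sup_right : N'.carrier ≤ N.carrier ⊔ N'.carrier)
  sup_le N N' K h h' := (sup_le h h' : N.carrier ⊔ N'.carrier ≤ K.carrier)
  inf_le_left N N' := (inf_le_left : N.carrier ⊓ N'.carrier ≤ N.carrier)
  inf_le_right N N' := (inf_le_right : N.carrier ⊓ N'.carrier ≤ N'.carrier)
  le_inf N N' K h h' := (le_inf h h' : N.carrier ≤ N'.carrier ⊓ K.carrier)

instance (M : Rep k α) : BoundedOrder M.Sub where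
  top := ⟨⊤, fun _ _ _ _ _ => trivial⟩
  bot := ⟨⊥, fun i j a x hx => by
    have : x = 0 := hx
    rw [this, map_zero]
    exact Submodule.zero_mem _⟩
  le_top N := (le_top : N.carrier ≤ ⊤)
  bot_le N := (bot_le : ⊥ ≤ N.carrier)

theorem Rep.Sub.le_iff {M : Rep k α} {N N' : M.Sub} : N ≤ N' ↔ ∀ i, N.carrier i ≤ N'.carrier i :=
  Iff.rfl

@[simp] theorem Rep.Sub.carrier_top {M : Rep k α} (i : V) : (⊤ : M.Sub).carrier i = ⊤ := rfl

@[simp] theorem Rep.Sub.carrier_bot {M : Rep k α} (i : V) : (⊥ : M.Sub).carrier i = ⊥ := rfl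

@[simp] theorem Rep.Sub.dim_top (M : Rep k α) : (⊤ : M.Sub).dim = α := by
  funext i
  simp [Rep.Sub.dim]

@[simp] theorem Rep.Sub.dim_bot (M : Rep k α) : (⊥ : M.Sub).dim = 0 := by
  funext i
  simp [Rep.Sub.dim]

theorem Rep.Sub.dim_sup_add_dim_inf {M : Rep k α} (N N' : M.Sub) :
    (N ⊔ N').dim + (N ⊓ N').dim = N.dim + N'.dim := by
  funext i
  exact Submodule.finrank_sup_add_finrank_inf_eq (N.carrier i) (N'.carrier i)

theorem Rep.Sub.dim_le {M : Rep k α} (N : M.Sub) : N.dim ≤ α := fun i => by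
  simpa [Rep.Sub.dim] using Submodule.finrank_le (N.carrier i)

theorem Rep.Sub.dim_eq_zero_iff {M : Rep k α} {N : M.Sub} : N.dim = 0 ↔ N = ⊥ := by
  constructor
  · intro h
    apply Rep.Sub.carrier_injective
    funext i
    exact Submodule.finrank_eq_zero.1 (congrFun h i)
  · rintro rfl
    exact Rep.Sub.dim_bot M

theorem Rep.Sub.dim_eq_iff {M : Rep k α} {N : M.Sub} : N.dim = α ↔ N = ⊤ := by
  constructor
  · intro h
    apply Rep.Sub.carrier_injective
    funext i
    refine Submodule.eq_top_of_finrank_eq ?_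
    simpa [Rep.Sub.dim] using congrFun h i
  · rintro rfl
    exact Rep.Sub.dim_top M

instance [Fintype V] [Finite k] (M : Rep k α) : Fintype M.Sub :=
  haveI : Finite M.Sub := Finite.of_injective _ Rep.Sub.carrier_injective
  Fintype.ofFinite _

/-- A family of linear maps which commutes with the arrows, i.e. a morphism `A → M`. -/
def IsHom (A : Rep k β) (M : Rep k α) (f : ∀ i, (Fin (β i) → k) →ₗ[k] (Fin (α i) → k)) : Prop :=
  ∀ i j (a : i ⟶ j) x, f j (A i j a x) = M i j a (f i x)

/-- The order embedding of subrepresentations induced by an injective morphism. -/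
def subEmbedding {A : Rep k β} {M : Rep k α}
    {f : ∀ i, (Fin (β i) → k) →ₗ[k] (Fin (α i) → k)} (hf : IsHom A M f)
    (hinj : ∀ i, Function.Injective (f i)) : A.Sub ↪o M.Sub :=
  OrderEmbedding.ofMapLEIff
    (fun N =>
      { carrier := fun i => (N.carrier i).map (f i)
        map_mem := by
          rintro i j a _ ⟨x, hx, rfl⟩
          exact ⟨A i j a x, N.map_mem i j a x hx, hf i j a x⟩ })
    (fun N N' => by
      simp only [Rep.Sub.le_iff]
      exact forall_congr' fun i => Submodule.map_le_map_iff_of_injective (hinj i) _ _)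

theorem subEmbedding_carrier {A : Rep k β} {M : Rep k α}
    {f : ∀ i, (Fin (β i) → k) →ₗ[k] (Fin (α i) → k)} (hf : IsHom A M f)
    (hinj : ∀ i, Function.Injective (f i)) (N : A.Sub) (i : V) :
    (subEmbedding hf hinj N).carrier i = (N.carrier i).map (f i) := rfl

theorem subEmbedding_dim {A : Rep k β} {M : Rep k α}
    {f : ∀ i, (Fin (β i) → k) →ₗ[k] (Fin (α i) → k)} (hf : IsHom A M f)
    (hinj : ∀ i, Function.Injective (f i)) (N : A.Sub) :
    (subEmbedding hf hinj N).dim = N.dim := by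
  funext i
  exact ((N.carrier i).equivMapOfInjective (f i) (hinj i)).finrank_eq.symm

theorem subEmbedding_exists_of_le {A : Rep k β} {M : Rep k α}
    {f : ∀ i, (Fin (β i) → k) →ₗ[k] (Fin (α i) → k)} (hf : IsHom A M f)
    (hinj : ∀ i, Function.Injective (f i)) (N : A.Sub) (K : M.Sub)
    (h : K ≤ subEmbedding hf hinj N) : ∃ K', subEmbedding hf hinj K' = K := by
  refine ⟨⟨fun i => (K.carrier i).comap (f i), fun i j a x hx => ?_⟩, ?_⟩
  · rw [Submodule.mem_comap] at hx ⊢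
    rw [hf]
    exact K.map_mem i j a _ hx
  · apply Rep.Sub.carrier_injective
    funext i
    rw [subEmbedding_carrier]
    refine Submodule.map_comap_eq_self ?_
    exact (h i).trans LinearMap.map_le_range

/-- Makes the chain count at `N` intrinsic: it depends only on `N` as a representation and not on
the ambient `M`, which is what factorisation over pairs `N ⊆ M` requires. -/
theorem mob_subEmbedding [Fintype V] [Finite k] (P : (V → ℕ) → Prop) {A : Rep k β} {M : Rep k α}
    {f : ∀ i, (Fin (β i) → k) →ₗ[k] (Fin (α i) → k)} (hf : IsHom A M f)
    (hinj : ∀ i, Function.Injective (f i)) (N : M.Sub)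
    (hN : ∀ i, N.carrier i = LinearMap.range (f i)) :
    mob (fun N : M.Sub => P N.dim) N = mob (fun N : A.Sub => P N.dim) ⊤ := by
  have : N = subEmbedding hf hinj ⊤ := by
    apply Rep.Sub.carrier_injective
    funext i
    rw [hN, subEmbedding_carrier, Rep.Sub.carrier_top, Submodule.map_top]
  rw [this]
  refine mob_embedding _ (subEmbedding_exists_of_le hf hinj) (fun x => ?_) ⊤
  rw [subEmbedding_dim]

end SubLattice

/-! ### Slopes and semistability -/

section Slopes

variable {V : Type*} [Fintype V]

/-- The linear functional `β ↦ ∑ᵢ (θᵢ - μ_θ(α)) βᵢ`, which has the sign of `μ_θ(β) - μ_θ(α)`. -/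
def excess (θ : V → ℝ) (α β : V → ℕ) : ℝ := ∑ i, (θ i - slope θ α) * (β i : ℝ)

theorem excess_add (θ : V → ℝ) (α β γ : V → ℕ) :
    excess θ α (β + γ) = excess θ α β + excess θ α γ := by
  simp [excess, mul_add, Finset.sum_add_distrib]

@[simp] theorem excess_zero (θ : V → ℝ) (α : V → ℕ) : excess θ α 0 = 0 := by
  simp [excess]

theorem sum_cast_pos {β : V → ℕ} (hβ : β ≠ 0) : 0 < ∑ i, (β i : ℝ) := by
  obtain ⟨i, hi⟩ := Function.ne_iff.1 hβ
  exact Finset.sum_pos' (fun _ _ => Nat.cast_nonneg _)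
    ⟨i, Finset.mem_univ i, Nat.cast_pos.2 (Nat.pos_of_ne_zero hi)⟩

theorem excess_eq (θ : V → ℝ) (α : V → ℕ) {β : V → ℕ} (hβ : β ≠ 0) :
    excess θ α β = (slope θ β - slope θ α) * ∑ i, (β i : ℝ) := by
  have h : slope θ β * ∑ i, (β i : ℝ) = ∑ i, θ i * (β i : ℝ) :=
    div_mul_cancel₀ _ (sum_cast_pos hβ).ne'
  rw [sub_mul, h, Finset.mul_sum, ← Finset.sum_sub_distrib]
  exact Finset.sum_congr rfl fun i _ => sub_mul _ _ _

theorem excess_pos_iff (θ : V → ℝ) (α : V → ℕ) {β : V → ℕ} (hβ : β ≠ 0) :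
    0 < excess θ α β ↔ slope θ α < slope θ β := by
  rw [excess_eq θ α hβ, mul_pos_iff_of_pos_right (sum_cast_pos hβ), sub_pos]

theorem excess_self (θ : V → ℝ) {α : V → ℕ} (hα : α ≠ 0) : excess θ α α = 0 := by
  rw [excess_eq θ α hα, sub_self, zero_mul]

end Slopes

/-! ### Semistability as a signed count of chains -/

section Semistable

variable {V : Type*} [Quiver V] [Fintype V] {k : Type*} [Field k] {α : V → ℕ}

theorem isSemistable_zero (M : Rep k α) : M.IsSemistable 0 := by
  intro N _ _
  simp [slope]

theorem isSemistable_iff {θ : V → ℝ} (hα : α ≠ 0) (M : Rep k α) :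
    M.IsSemistable θ ↔ ∀ N : M.Sub, ¬ 0 < excess θ α N.dim := by
  constructor
  · intro h N hN
    have h0 : N.dim ≠ 0 := fun h0 => by simp [h0] at hN
    refine (h N (fun hb => h0 ?_) (fun ht => ?_)).not_gt ((excess_pos_iff θ α h0).1 hN)
    · exact Rep.Sub.dim_eq_zero_iff.2 (Rep.Sub.carrier_injective hb)
    · have : N = ⊤ := Rep.Sub.carrier_injective ht
      simp [this, excess_self θ hα] at hN
  · intro h N hN _
    have h0 : N.dim ≠ 0 := fun h0 =>
      hN (congrArg Rep.Sub.carrier (Rep.Sub.dim_eq_zero_iff.1 h0))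
    exact not_lt.1 fun hlt => h N ((excess_pos_iff θ α h0).2 hlt)

/-- If `M` is semistable, only `⊥` contributes. Otherwise the excess is modular on
subrepresentations, so a `D` of maximal excess satisfies the hypothesis of `sum_mob_eq_zero`. -/
theorem sum_mob_lt_top [Finite k] (θ : V → ℝ) (hα : α ≠ 0) (M : Rep k α) :
    ∑ N : M.Sub with N.dim ≠ α, mob (fun N : M.Sub => 0 < excess θ α N.dim) N
      = if M.IsSemistable θ then 1 else 0 := by
  have htop : (⊤ : M.Sub) ≠ ⊥ := fun h => hα (by
    have := Rep.Sub.dim_bot M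
    rwa [← h, Rep.Sub.dim_top] at this)
  -- The full subrepresentation has excess zero, hence is not positive, and may be added freely.
  have hall : ∑ N : M.Sub with N.dim ≠ α, mob (fun N : M.Sub => 0 < excess θ α N.dim) N
      = ∑ N : M.Sub, mob (fun N : M.Sub => 0 < excess θ α N.dim) N := by
    refine Finset.sum_subset (Finset.subset_univ _) fun N _ hN => ?_
    have hN' : N = ⊤ := Rep.Sub.dim_eq_iff.1 (by simpa using hN)
    rw [hN']
    exact mob_of_not htop (by simp [excess_self θ hα])
  rw [hall]
  split_ifs with h
  · rw [isSemistable_iff hα] at h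
    rw [Finset.sum_eq_single ⊥, mob_bot]
    · exact fun N _ hN => mob_of_not hN (h N)
    · simp
  · rw [isSemistable_iff hα] at h
    push Not at h
    obtain ⟨N, hN⟩ := h
    obtain ⟨D, hD⟩ := Finite.exists_max (fun D : M.Sub => excess θ α D.dim)
    have hDpos : 0 < excess θ α D.dim := hN.trans_le (hD N)
    -- Modularity gives `excess (K ⊔ D) = excess K + (excess D - excess (K ⊓ D))`, and the bracket
    -- is nonnegative by maximality of `D`.
    refine sum_mob_eq_zero hDpos (fun h => by simp [h] at hDpos) fun K hK => ?_
    have h1 := congrArg (excess θ α) (Rep.Sub.dim_sup_add_dim_inf K D)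
    rw [excess_add, excess_add] at h1
    have h2 := hD (K ⊓ D)
    linarith

end Semistable

/-! ### Sums over isomorphism classes -/

section Finiteness

variable {V : Type*} [Quiver V] {k : Type*} [Field k] {α : V → ℕ}

instance [Finite k] {m n : ℕ} : Fintype ((Fin m → k) →ₗ[k] (Fin n → k)) :=
  haveI : Finite ((Fin m → k) →ₗ[k] (Fin n → k)) :=
    Finite.of_injective _ DFunLike.coe_injective
  Fintype.ofFinite _

/-- The isomorphism class of a representation. -/
def IsoClass.mk (M : Rep k α) : IsoClass k α := Quotient.mk (repSetoid k α) M

theorem IsoClass.mk_surjective : Function.Surjective (IsoClass.mk (k := k) (α := α)) :=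
  Quotient.mk_surjective

theorem IsoClass.mk_eq_mk {M N : Rep k α} :
    IsoClass.mk M = IsoClass.mk N ↔ Nonempty (Rep.Iso M N) :=
  Quotient.eq (r := repSetoid k α)

theorem IsoClass.autCard_mk (M : Rep k α) : (IsoClass.mk M).autCard = M.autCard := rfl

theorem IsoClass.trace_mk (W : Potential V k) (M : Rep k α) :
    (IsoClass.mk M).trace W = W.trace M := rfl

theorem IsoClass.isSemistable_mk [Fintype V] (θ : V → ℝ) (M : Rep k α) :
    (IsoClass.mk M).IsSemistable θ = M.IsSemistable θ := rfl

/-- The group `GL_α = ∏ᵢ GL(k ^ αᵢ)`. -/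
abbrev GLFamily {V : Type*} (k : Type*) [Field k] (α : V → ℕ) :=
  ∀ i, (Fin (α i) → k) ≃ₗ[k] (Fin (α i) → k)

/-- The order of `GL_α`. -/
def glCard {V : Type*} (k : Type*) [Field k] (α : V → ℕ) : ℕ := Nat.card (GLFamily k α)

instance [Finite k] {m n : ℕ} : Finite ((Fin m → k) ≃ₗ[k] (Fin n → k)) :=
  Finite.of_injective _ DFunLike.coe_injective

theorem Rep.Iso.target_eq {M N N' : Rep k α} {f : Rep.Iso M N} {f' : Rep.Iso M N'}
    (h : f.toEquiv = f'.toEquiv) : N = N' := by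
  funext i j a
  refine LinearMap.ext fun x => ?_
  obtain ⟨y, rfl⟩ := (f.toEquiv i).surjective x
  rw [← f.comm, h, f'.comm]

theorem Rep.card_iso {M N : Rep k α} (g : Rep.Iso M N) : Nat.card (Rep.Iso M N) = M.autCard := by
  refine Nat.card_congr ⟨fun f => f.trans g.symm, fun f => f.trans g, ?_, ?_⟩
  · intro f
    apply Rep.Iso.ext'
    funext i
    ext1 x
    simp [Rep.Iso.trans, Rep.Iso.symm]
  · intro f
    apply Rep.Iso.ext'
    funext i
    ext1 x
    simp [Rep.Iso.trans, Rep.Iso.symm]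

theorem glCard_pos {V : Type*} [Finite V] {k : Type*} [Field k] [Finite k] {α : V → ℕ} :
    0 < glCard k α :=
  haveI : Nonempty (GLFamily k α) := ⟨fun _ => LinearEquiv.refl k _⟩
  Nat.card_pos

variable [Fintype V] [∀ i j : V, Fintype (i ⟶ j)]

/-- Orbit-stabiliser: an element of `GL_α` is the same as a representation `N` together with an
isomorphism `M → N`, and every nonempty set of isomorphisms has `# Aut M` elements. -/
theorem card_orbit_mul_autCard [Finite k] (M : Rep k α) :
    Nat.card {N : Rep k α // Nonempty (Rep.Iso M N)} * M.autCard = glCard k α := by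
  have e : (Σ N : {N : Rep k α // Nonempty (Rep.Iso M N)}, Rep.Iso M N.1) ≃ GLFamily k α := by
    refine Equiv.ofBijective (fun x => x.2.toEquiv) ⟨?_, ?_⟩
    · rintro ⟨⟨N, hN⟩, f⟩ ⟨⟨N', hN'⟩, f'⟩ h
      obtain rfl := Rep.Iso.target_eq h
      obtain rfl := Rep.Iso.ext' h
      rfl
    · intro g
      let f : Rep.Iso M (fun i j a => (g j).toLinearMap ∘ₗ M i j a ∘ₗ (g i).symm.toLinearMap) :=
        ⟨g, fun i j a x => by simp⟩
      exact ⟨⟨⟨_, ⟨f⟩⟩, f⟩, rfl⟩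
  have : ∀ N : Rep k α, Finite (Rep.Iso M N) := fun N =>
    Finite.of_injective (Rep.Iso.toEquiv : _ → GLFamily k α) fun _ _ h => Rep.Iso.ext' h
  rw [glCard, ← Nat.card_congr e, Nat.card_sigma]
  simp only [fun N : {N : Rep k α // Nonempty (Rep.Iso M N)} => N.2.elim Rep.card_iso]
  simp [Nat.card_eq_fintype_card]

theorem autCard_pos [Finite k] (M : Rep k α) : 0 < M.autCard :=
  Nat.pos_of_mul_pos_left ((card_orbit_mul_autCard M).symm ▸ glCard_pos)

/-- The class of `M` has `# GL_α / # Aut M` members in `R(Q, α)`. -/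
theorem sum_isoClass [Fintype k] (F : IsoClass k α → ℝ) :
    ∑ c : IsoClass k α, F c / (c.autCard : ℝ)
      = (∑ M : Rep k α, F (IsoClass.mk M)) / (glCard k α : ℝ) := by
  rw [← Finset.sum_fiberwise Finset.univ (IsoClass.mk (k := k) (α := α)), Finset.sum_div]
  refine Finset.sum_congr rfl fun c _ => ?_
  obtain ⟨M, rfl⟩ := IsoClass.mk_surjective c
  have hg : (glCard k α : ℝ) ≠ 0 := Nat.cast_ne_zero.2 glCard_pos.ne'
  have hM : (M.autCard : ℝ) ≠ 0 := Nat.cast_ne_zero.2 (autCard_pos M).ne'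
  have hcard : (Finset.univ.filter (fun N : Rep k α => IsoClass.mk N = IsoClass.mk M)).card
      = Nat.card {N : Rep k α // Nonempty (Rep.Iso M N)} := by
    rw [Nat.card_eq_fintype_card, Fintype.card_subtype]
    congr 1
    ext N
    simp only [Finset.mem_filter, Finset.mem_univ, true_and]
    rw [eq_comm, IsoClass.mk_eq_mk]
  rw [Finset.sum_congr rfl (g := fun _ => F (IsoClass.mk M))
    (fun N hN => by rw [(Finset.mem_filter.1 hN).2]), Finset.sum_const, hcard, nsmul_eq_mul,
    IsoClass.autCard_mk, div_eq_div_iff hM hg, ← card_orbit_mul_autCard M]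
  push_cast
  ring

end Finiteness

/-! ### The torus action and the character sum -/

section Torus

variable {V : Type*} [Quiver V] {k : Type*} [Field k] {α : V → ℕ}

/-- Rescaling the maps of a representation. -/
def Rep.scale (c : ∀ i j : V, (i ⟶ j) → kˣ) (M : Rep k α) : Rep k α :=
  fun i j a => (c i j a : k) • M i j a

/-- Rescaling as a permutation of `R(Q, α)`. -/
def Rep.scaleEquiv (c : ∀ i j : V, (i ⟶ j) → kˣ) : Rep k α ≃ Rep k α where
  toFun := Rep.scale c
  invFun := Rep.scale c⁻¹
  left_inv M := by
    funext i j a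
    simp [Rep.scale, smul_smul]
  right_inv M := by
    funext i j a
    simp [Rep.scale, smul_smul]

/-- Multiplying arrow maps by units does not change which families of subspaces are
subrepresentations. -/
theorem Rep.isSemistable_scale_of [Fintype V] {θ : V → ℝ} (c : ∀ i j : V, (i ⟶ j) → kˣ)
    {M : Rep k α} (h : M.IsSemistable θ) : (M.scale c).IsSemistable θ := by
  intro N hb ht
  refine h ⟨N.carrier, fun i j a x hx => ?_⟩ hb ht
  have h1 := N.map_mem i j a x hx
  simp only [Rep.scale, LinearMap.smul_apply] at h1
  exact (Submodule.smul_mem_iff _ (c i j a).ne_zero).1 h1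

theorem Rep.isSemistable_scale [Fintype V] {θ : V → ℝ} (c : ∀ i j : V, (i ⟶ j) → kˣ)
    {M : Rep k α} : (M.scale c).IsSemistable θ ↔ M.IsSemistable θ := by
  refine ⟨fun h => ?_, Rep.isSemistable_scale_of c⟩
  have h1 := Rep.isSemistable_scale_of c⁻¹ h
  rwa [show (M.scale c).scale c⁻¹ = M from (Rep.scaleEquiv c).left_inv M] at h1

/-- The weights of the arrows given by a homomorphism `Λ → ℤ`. -/
def Potential.arrowWeight (W : Potential V k) (s : W.Lambda →+ ℤ) (i j : V) (a : i ⟶ j) : ℤ :=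
  s (QuotientAddGroup.mk' W.relations (Finsupp.single (⟨i, j, a⟩ : Quiver.Total V) 1, 0))

theorem pathMap_scale (W : Potential V k) (s : W.Lambda →+ ℤ) (t : kˣ) (M : Rep k α) {i j : V}
    (p : Quiver.Path i j) :
    (M.scale fun i j a => t ^ W.arrowWeight s i j a).pathMap p
      = ((t ^ s (QuotientAddGroup.mk' W.relations
          (p.addWeight fun {i j} (a : i ⟶ j) =>
            Finsupp.single (⟨i, j, a⟩ : Quiver.Total V) (1 : ℤ), 0)) : kˣ) : k) • M.pathMap p := by
  induction p with
  | nil =>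
    simp only [Rep.pathMap, Quiver.Path.addWeight_nil]
    rw [← Prod.zero_eq_mk, map_zero, map_zero, zpow_zero, Units.val_one, one_smul]
  | @cons j l p a ih =>
    simp only [Rep.pathMap, Quiver.Path.addWeight_cons]
    -- Splitting the second coordinate as `0 + 0` exposes a sum in `ℤ^{Q₁} × ℤ`, to which additivity
    -- of `s` applies.
    rw [ih, ← add_zero (0 : ℤ), ← Prod.mk_add_mk, map_add, map_add, zpow_add, Units.val_mul,
      mul_comm, mul_smul, LinearMap.comp_smul, add_zero]
    simp only [Rep.scale, Potential.arrowWeight, LinearMap.smul_comp]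
    rw [smul_comm]

/-- In `Λ` the content of a cycle of `W` equals `ω(1)`, because `(content, 0) - (0, 1)` is one of
the defining relations; a splitting sends `ω(1)` to `1`. -/
theorem Potential.apply_content {W : Potential V k} {s : W.Lambda →+ ℤ}
    (hs : s.comp W.omega = AddMonoidHom.id ℤ) {u : CyclePath V} (hu : u ∈ W.support) :
    s (QuotientAddGroup.mk' W.relations (u.content, 0)) = 1 := by
  have h1 : s (QuotientAddGroup.mk' W.relations (0, 1)) = 1 := DFunLike.congr_fun hs 1
  rw [← h1]
  congr 1
  refine QuotientAddGroup.eq_iff_sub_mem.2 ?_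
  have : ((u.content, 0) : (Quiver.Total V →₀ ℤ) × ℤ) - (0, 1) = (u.content, -1) := by simp
  rw [this]
  exact AddSubgroup.subset_closure ⟨u, hu, rfl⟩

/-- Every cycle occurring in `W` has total weight `1` for the arrow weights given by `s`, so each of
its terms is multiplied by `t`. -/
theorem Potential.trace_scale {W : Potential V k} {s : W.Lambda →+ ℤ}
    (hs : s.comp W.omega = AddMonoidHom.id ℤ) (t : kˣ) (M : Rep k α) :
    W.trace (M.scale fun i j a => t ^ W.arrowWeight s i j a) = t * W.trace M := by
  unfold Potential.trace Finsupp.sum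
  rw [Finset.mul_sum]
  refine Finset.sum_congr rfl fun u hu => ?_
  have h1 := Potential.apply_content hs hu
  unfold CyclePath.content at h1
  beta_reduce
  rw [pathMap_scale, h1, zpow_one, map_smul, smul_eq_mul]
  ring

variable [Fintype V] [∀ i j : V, Fintype (i ⟶ j)] [Fintype k]

/-- The sum of `ψ(w(M)) f(M)` over the space `R(Q, α)`. -/
def charSum (ψ : AddChar k ℂ) (W : Potential V k) (f : Rep k α → ℂ) : ℂ :=
  ∑ M : Rep k α, ψ (W.trace M) * f M

/-- Evaluate `∑_t ∑_M ψ(t w(M)) f(M)` twice. Summing over `t` first, orthogonality leaves `q` times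
the part with `w = 0`. Summing over `M` first, `t = 0` gives `∑ f`, and each of the `q - 1` other
values gives `charSum` by rescaling. -/
theorem card_sub_one_mul_charSum {W : Potential V k} (hW : W.IsPrimitive) {ψ : AddChar k ℂ}
    (hψ : ψ.IsPrimitive) {f : Rep k α → ℂ} (hf : ∀ c M, f (Rep.scale c M) = f M) :
    ((1 : ℂ) - Fintype.card k) * charSum ψ W f
      = ∑ M, f M - Fintype.card k * ∑ M, if W.trace M = 0 then f M else 0 := by
  obtain ⟨s, hs⟩ := hW
  have h1 : ∀ t : k, t ≠ 0 → ∑ M : Rep k α, ψ (t * W.trace M) * f M = charSum ψ W f := by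
    intro t ht
    refine Fintype.sum_equiv
      (Rep.scaleEquiv fun i j a => Units.mk0 t ht ^ W.arrowWeight s i j a) _ _ fun M => ?_
    change _ = ψ (W.trace (Rep.scale _ M)) * f (Rep.scale _ M)
    rw [Potential.trace_scale hs, hf, Units.val_mk0]
  have h2 : ∑ t : k, ∑ M : Rep k α, ψ (t * W.trace M) * f M
      = Fintype.card k * ∑ M, if W.trace M = 0 then f M else 0 := by
    rw [Finset.sum_comm, Finset.mul_sum]
    refine Finset.sum_congr rfl fun M _ => ?_
    rw [← Finset.sum_mul, AddChar.sum_mulShift _ hψ]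
    split_ifs <;> simp
  rw [← Finset.add_sum_erase _ _ (Finset.mem_univ (0 : k)),
    Finset.sum_congr rfl (fun t ht => h1 t (Finset.ne_of_mem_erase ht)), Finset.sum_const,
    Finset.card_erase_of_mem (Finset.mem_univ _), Finset.card_univ, nsmul_eq_mul,
    Nat.cast_sub Fintype.card_pos] at h2
  simp only [zero_mul, AddChar.map_zero_eq_one, one_mul] at h2
  rw [← h2]
  push_cast
  ring

/-- The factor `(-q^{1/2})^{T(α)} / # GL_α`. -/
def normFactor (k : Type*) [Field k] [Fintype k] (α : V → ℕ) : ℂ :=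
  (negSqrt k : ℂ) ^ titsForm (toInt α) / glCard k α

theorem intMap_eq (f : HallHat V k) (α : V → ℕ) :
    ((intMap f α : ℝ) : ℂ) = normFactor k α * ∑ M : Rep k α, (f α (IsoClass.mk M) : ℂ) := by
  have h : intMap f α = negSqrt k ^ titsForm (toInt α) *
      ((∑ M : Rep k α, f α (IsoClass.mk M)) / (glCard k α : ℝ)) := by
    rw [← sum_isoClass, Finset.mul_sum]
    refine Finset.sum_congr rfl fun c _ => ?_
    ring
  rw [h, normFactor]
  push_cast
  ring

theorem dtInvariant_eq {W : Potential V k} (hW : W.IsPrimitive) {ψ : AddChar k ℂ}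
    (hψ : ψ.IsPrimitive) (θ : V → ℝ) (α : V → ℕ) :
    (dtInvariant W θ α : ℂ)
      = normFactor k α *
        charSum (α := α) ψ W fun M => if M.IsSemistable θ then 1 else 0 := by
  have hq : (1 : ℂ) - Fintype.card k ≠ 0 := by
    rw [sub_ne_zero]
    exact_mod_cast (Fintype.one_lt_card (α := k)).ne
  unfold dtInvariant intEq
  push_cast
  rw [intMap_eq, intMap_eq, div_eq_iff hq, mul_assoc, mul_comm (charSum _ _ _),
    card_sub_one_mul_charSum hW hψ
      (fun c M => by simp only [Rep.isSemistable_scale]), mul_left_comm, ← mul_sub]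
  congr 2
  · refine Finset.sum_congr rfl fun M _ => ?_
    simp only [ssElement, IsoClass.isSemistable_mk, true_and]
    split_ifs <;> simp
  · congr 1
    refine Finset.sum_congr rfl fun M _ => ?_
    simp only [zeroPart, ssElement, IsoClass.isSemistable_mk, IsoClass.trace_mk]
    split_ifs <;> simp_all

theorem dtInvariant_zero_eq {W : Potential V k} (hW : W.IsPrimitive) {ψ : AddChar k ℂ}
    (hψ : ψ.IsPrimitive) (α : V → ℕ) :
    (dtInvariant W 0 α : ℂ) = normFactor k α * charSum (α := α) ψ W 1 := by
  rw [dtInvariant_eq hW hψ]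
  congr 2
  funext M
  exact if_pos (isSemistable_zero M)

end Torus

/-! ### Counting injective maps and automorphisms -/

section Counting

variable {k : Type*} [Field k] [Fintype k]

theorem card_injective_linearMap {a b : ℕ} (h : b ≤ a) :
    Nat.card {f : (Fin b → k) →ₗ[k] (Fin a → k) // Function.Injective f}
      = ∏ i : Fin b, (Fintype.card k ^ a - Fintype.card k ^ (i : ℕ)) := by
  have h1 := card_linearIndependent (K := k) (V := Fin a → k) (k := b) (by simpa using h)
  rw [Module.finrank_fin_fun] at h1
  rw [← h1]
  refine Nat.card_congr (Equiv.subtypeEquiv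
    ((Pi.basisFun k (Fin b)).constr k).toEquiv fun v => ?_).symm
  rw [linearIndependent_iff_injective_fintypeLinearCombination]
  have : ∀ x, (Pi.basisFun k (Fin b)).constr k v x = Fintype.linearCombination k v x := by
    intro x
    simp [Module.Basis.constr_apply_fintype, Fintype.linearCombination_apply]
  rw [← show ⇑((Pi.basisFun k (Fin b)).constr k v) = ⇑(Fintype.linearCombination k v) from
    funext this]
  rfl

theorem card_linearEquiv_eq {k : Type*} [Field k] (n : ℕ) :
    Nat.card ((Fin n → k) ≃ₗ[k] (Fin n → k))
      = Nat.card {f : (Fin n → k) →ₗ[k] (Fin n → k) // Function.Injective f} := by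
  refine Nat.card_congr
    ⟨fun e => ⟨e.toLinearMap, e.injective⟩, fun f => LinearEquiv.ofInjectiveEndo f.1 f.2, ?_, ?_⟩
  · intro e
    ext1 x
    rfl
  · intro f
    rfl

/-- In `∏_{i < b+c} (q^{b+c} - q^i)` the first `b` factors count the injections, and each of the
other `c` factors is `q^b` times a factor of `# GL_c`. -/
theorem card_linearEquiv_add (b c : ℕ) :
    Nat.card ((Fin (b + c) → k) ≃ₗ[k] (Fin (b + c) → k))
      = Nat.card {f : (Fin b → k) →ₗ[k] (Fin (b + c) → k) // Function.Injective f}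
        * Fintype.card k ^ (b * c) * Nat.card ((Fin c → k) ≃ₗ[k] (Fin c → k)) := by
  rw [card_linearEquiv_eq, card_linearEquiv_eq, card_injective_linearMap le_rfl,
    card_injective_linearMap (Nat.le_add_right b c), card_injective_linearMap le_rfl,
    Fin.prod_univ_add, mul_assoc]
  simp only [Fin.val_castAdd, Fin.val_natAdd]
  congr 1
  have h : Fintype.card k ^ (b * c) = ∏ _i : Fin c, Fintype.card k ^ b := by
    rw [Fin.prod_const, pow_mul]
  rw [h, ← Finset.prod_mul_distrib]
  refine Finset.prod_congr rfl fun i _ => ?_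
  rw [Nat.mul_sub, pow_add, pow_add]

theorem exists_linearEquiv_prod {k : Type*} [Field k] {a b c : ℕ} (h : b + c = a) (f : (Fin b → k) →ₗ[k] (Fin a → k))
    (hf : Function.Injective f) :
    ∃ φ : ((Fin b → k) × (Fin c → k)) ≃ₗ[k] (Fin a → k), ∀ x, φ (x, 0) = f x := by
  obtain ⟨C, hC⟩ := Submodule.exists_isCompl (LinearMap.range f)
  have h1 := Submodule.finrank_add_eq_of_isCompl hC
  rw [LinearMap.finrank_range_of_inj hf, Module.finrank_fin_fun, Module.finrank_fin_fun] at h1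
  have e : (Fin c → k) ≃ₗ[k] C :=
    LinearEquiv.ofFinrankEq _ _ (by rw [Module.finrank_fin_fun]; omega)
  refine ⟨((LinearEquiv.ofInjective f hf).prodCongr e).trans
    (Submodule.prodEquivOfIsCompl _ _ hC), fun x => ?_⟩
  simp

variable {V : Type*} [Fintype V]

/-- Families of injective linear maps `k ^ βᵢ → k ^ αᵢ`. -/
abbrev InjFamily (k : Type*) [Field k] (β α : V → ℕ) :=
  ∀ i, {f : (Fin (β i) → k) →ₗ[k] (Fin (α i) → k) // Function.Injective f}

theorem glCard_add (β γ : V → ℕ) :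
    glCard k (β + γ) = Nat.card (InjFamily k β (β + γ))
      * Fintype.card k ^ (∑ i, β i * γ i) * glCard k γ := by
  rw [glCard, glCard, Nat.card_pi, Nat.card_pi, Nat.card_pi, ← Finset.prod_pow_eq_pow_sum,
    ← Finset.prod_mul_distrib, ← Finset.prod_mul_distrib]
  exact Finset.prod_congr rfl fun i _ => card_linearEquiv_add (β i) (γ i)

/-- The parametrisations of a subspace family of dimension vector `β` form a torsor under `GL_β`. -/
theorem card_injFamily_range_eq (β α : V → ℕ) (U : ∀ i, Submodule k (Fin (α i) → k)) :
    (Finset.univ.filter fun f : InjFamily k β α => ∀ i, U i = LinearMap.range (f i).1).card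
      = if (fun i => Module.finrank k (U i)) = β then glCard k β else 0 := by
  split_ifs with h
  · have e : ∀ i, U i ≃ₗ[k] (Fin (β i) → k) := fun i =>
      LinearEquiv.ofFinrankEq _ _ (by rw [Module.finrank_fin_fun]; exact congrFun h i)
    rw [← Fintype.card_subtype, ← Nat.card_eq_fintype_card, glCard]
    symm
    refine Nat.card_congr (Equiv.ofBijective (fun g => ⟨fun i =>
      ⟨(U i).subtype ∘ₗ (e i).symm.toLinearMap ∘ₗ (g i).toLinearMap,
        (U i).injective_subtype.comp ((e i).symm.injective.comp (g i).injective)⟩,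
        fun i => ?_⟩) ⟨?_, ?_⟩)
    · rw [LinearMap.range_comp, LinearMap.range_comp, LinearEquiv.range, Submodule.map_top,
        LinearEquiv.range, Submodule.map_top, Submodule.range_subtype]
    · intro g g' hg
      funext i
      ext1 x
      have h1 := congrArg (fun F => (F.1 i).1 x) hg
      exact (e i).symm.injective (Subtype.ext h1)
    · rintro ⟨f, hf⟩
      refine ⟨fun i => (LinearEquiv.ofInjective (f i).1 (f i).2).trans
        ((LinearEquiv.ofEq _ _ (hf i).symm).trans (e i)), ?_⟩
      ext1
      funext i
      ext1
      refine LinearMap.ext fun x => ?_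
      simp
  · rw [Finset.card_eq_zero, Finset.filter_eq_empty_iff]
    intro f _ hf
    apply h
    funext i
    rw [hf i, LinearMap.finrank_range_of_inj (f i).2, Module.finrank_fin_fun]

end Counting

/-! ### Block triangular representations -/

section Block

variable {V : Type*} [Quiver V] {k : Type*} [Field k] {α β γ : V → ℕ}

/-- The off-diagonal blocks of block triangular representations. -/
abbrev OffDiag (k : Type*) [Field k] (γ β : V → ℕ) :=
  ∀ i j : V, (i ⟶ j) → ((Fin (γ i) → k) →ₗ[k] (Fin (β j) → k))

/-- The block triangular representation with diagonal blocks `A`, `D` and off-diagonal block `B`,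
with respect to the decompositions `φ`. -/
def blockRep (φ : ∀ i, ((Fin (β i) → k) × (Fin (γ i) → k)) ≃ₗ[k] (Fin (α i) → k))
    (x : (Rep k β × Rep k γ) × OffDiag k γ β) : Rep k α := fun i j a =>
  (φ j).toLinearMap ∘ₗ
    (((x.1.1 i j a) ∘ₗ LinearMap.fst k _ _ + (x.2 i j a) ∘ₗ LinearMap.snd k _ _).prod
      ((x.1.2 i j a) ∘ₗ LinearMap.snd k _ _)) ∘ₗ (φ i).symm.toLinearMap

variable (φ : ∀ i, ((Fin (β i) → k) × (Fin (γ i) → k)) ≃ₗ[k] (Fin (α i) → k))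

theorem blockRep_apply (x : (Rep k β × Rep k γ) × OffDiag k γ β) {i j : V} (a : i ⟶ j)
    (y : (Fin (β i) → k) × (Fin (γ i) → k)) :
    blockRep φ x i j a (φ i y)
      = φ j (x.1.1 i j a y.1 + x.2 i j a y.2, x.1.2 i j a y.2) := by
  simp [blockRep]

theorem blockRep_injective : Function.Injective (blockRep φ) := by
  intro x x' h
  have h1 : ∀ i j (a : i ⟶ j) (y : (Fin (β i) → k) × (Fin (γ i) → k)), (x.1.1 i j a y.1 + x.2 i j a y.2, x.1.2 i j a y.2)
      = (x'.1.1 i j a y.1 + x'.2 i j a y.2, x'.1.2 i j a y.2) := fun i j a y => by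
    apply (φ j).injective
    rw [← blockRep_apply, ← blockRep_apply, h]
  refine Prod.ext (Prod.ext ?_ ?_) ?_
  all_goals
    funext i j a
    refine LinearMap.ext fun y => ?_
  · simpa using congrArg Prod.fst (h1 i j a (y, 0))
  · exact congrArg Prod.snd (h1 i j a (0, y))
  · simpa using congrArg Prod.fst (h1 i j a (0, y))

/-- The hypothesis says that the block from the `β`-part to the `γ`-part vanishes; the other three
blocks are read off with the projections and inclusions. -/
theorem mem_range_blockRep {M : Rep k α}
    (h : ∀ i j (a : i ⟶ j) y, ((φ j).symm (M i j a (φ i (y, 0)))).2 = 0) :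
    M ∈ Set.range (blockRep φ) := by
  refine ⟨((fun i j a => LinearMap.fst k _ _ ∘ₗ (φ j).symm.toLinearMap ∘ₗ M i j a ∘ₗ
      (φ i).toLinearMap ∘ₗ LinearMap.inl k _ _,
    fun i j a => LinearMap.snd k _ _ ∘ₗ (φ j).symm.toLinearMap ∘ₗ M i j a ∘ₗ
      (φ i).toLinearMap ∘ₗ LinearMap.inr k _ _),
    fun i j a => LinearMap.fst k _ _ ∘ₗ (φ j).symm.toLinearMap ∘ₗ M i j a ∘ₗ
      (φ i).toLinearMap ∘ₗ LinearMap.inr k _ _), ?_⟩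
  funext i j a
  refine LinearMap.ext fun z => ?_
  obtain ⟨⟨y, z⟩, rfl⟩ := (φ i).surjective z
  rw [blockRep_apply, ← LinearEquiv.eq_symm_apply]
  have hyz : ((y, z) : (Fin (β i) → k) × (Fin (γ i) → k)) = (y, 0) + (0, z) := by simp
  rw [hyz, map_add, map_add, map_add]
  refine Prod.ext ?_ ?_
  · simp
  · simp [h]

theorem pathMap_blockRep_inl (x : (Rep k β × Rep k γ) × OffDiag k γ β) {i j : V}
    (p : Quiver.Path i j) (y : Fin (β i) → k) :
    (blockRep φ x).pathMap p (φ i (y, 0)) = φ j (x.1.1.pathMap p y, 0) := by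
  induction p with
  | nil => rfl
  | cons p a ih => simp [Rep.pathMap, ih, blockRep_apply]

theorem pathMap_blockRep_snd (x : (Rep k β × Rep k γ) × OffDiag k γ β) {i j : V}
    (p : Quiver.Path i j) (y : (Fin (β i) → k) × (Fin (γ i) → k)) :
    ((φ j).symm ((blockRep φ x).pathMap p (φ i y))).2 = x.1.2.pathMap p y.2 := by
  induction p with
  | nil => simp [Rep.pathMap]
  | @cons j l p a ih =>
    obtain ⟨z, hz⟩ := (φ j).surjective ((blockRep φ x).pathMap p (φ i y))
    rw [← hz, LinearEquiv.symm_apply_apply] at ih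
    simp only [Rep.pathMap, LinearMap.comp_apply]
    rw [← hz, blockRep_apply, LinearEquiv.symm_apply_apply, ih]

/-- Write the conjugated map as a sum of two maps, each factoring through one of the projections;
cyclicity of the trace then leaves the two diagonal blocks. -/
theorem trace_of_block {X Y E : Type*} [AddCommGroup X] [Module k X] [FiniteDimensional k X]
    [AddCommGroup Y] [Module k Y] [FiniteDimensional k Y] [AddCommGroup E] [Module k E]
    (φ : (X × Y) ≃ₗ[k] E) {F : E →ₗ[k] E} {A : X →ₗ[k] X} {D : Y →ₗ[k] Y}
    (hA : ∀ x, F (φ (x, 0)) = φ (A x, 0)) (hD : ∀ y, (φ.symm (F (φ y))).2 = D y.2) :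
    LinearMap.trace k E F = LinearMap.trace k X A + LinearMap.trace k Y D := by
  rw [← LinearMap.trace_conj' F φ.symm]
  set G := φ.symm.conj F with hG
  have hsplit : G = (G ∘ₗ LinearMap.inl k X Y) ∘ₗ LinearMap.fst k X Y
      + (G ∘ₗ LinearMap.inr k X Y) ∘ₗ LinearMap.snd k X Y := by
    refine LinearMap.ext fun z => ?_
    rw [LinearMap.add_apply]
    simp only [LinearMap.comp_apply]
    rw [← map_add]
    simp
  rw [hsplit, map_add, LinearMap.trace_comp_comm' (LinearMap.fst k X Y),
    LinearMap.trace_comp_comm' (LinearMap.snd k X Y)]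
  congr 2
  · refine LinearMap.ext fun x => ?_
    simp [hG, LinearEquiv.conj_apply, hA]
  · refine LinearMap.ext fun y => ?_
    simp [hG, LinearEquiv.conj_apply, hD]

theorem trace_blockRep (W : Potential V k) (x : (Rep k β × Rep k γ) × OffDiag k γ β) :
    W.trace (blockRep φ x) = W.trace x.1.1 + W.trace x.1.2 := by
  unfold Potential.trace Finsupp.sum
  rw [← Finset.sum_add_distrib]
  refine Finset.sum_congr rfl fun u _ => ?_
  beta_reduce
  rw [← mul_add, trace_of_block (φ u.base) (pathMap_blockRep_inl φ x u.path)
    (pathMap_blockRep_snd φ x u.path)]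

end Block

/-! ### The product formula -/

section Product

variable {V : Type*} [Quiver V] [Fintype V] [∀ i j : V, Fintype (i ⟶ j)]
  {k : Type*} [Field k] [Fintype k] {α β γ : V → ℕ}

theorem card_offDiag (γ β : V → ℕ) :
    Fintype.card (OffDiag k γ β)
      = Fintype.card k ^ ∑ i, ∑ j, ∑ _a : (i ⟶ j), γ i * β j := by
  rw [← Nat.card_eq_fintype_card, Nat.card_pi, ← Finset.prod_pow_eq_pow_sum]
  refine Finset.prod_congr rfl fun i _ => ?_
  rw [Nat.card_pi, ← Finset.prod_pow_eq_pow_sum]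
  refine Finset.prod_congr rfl fun j _ => ?_
  rw [Nat.card_pi, ← Finset.prod_pow_eq_pow_sum]
  refine Finset.prod_congr rfl fun a _ => ?_
  rw [Module.natCard_eq_pow_finrank (K := k), Module.finrank_linearMap, Nat.card_eq_fintype_card]
  simp

/-- Replace a subrepresentation by an injective family `f` with that image, at the cost of the
factor `# GL_β`. For fixed `f`, the representations preserving its image are exactly the block
triangular ones, on which `ψ ∘ w` is multiplicative and independent of the off-diagonal block. The
hypothesis `hF` says that `F M N` depends only on `N` as a representation. -/
theorem sum_sub_charSum (ψ : AddChar k ℂ) (W : Potential V k) (hα : β + γ = α)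
    (F : ∀ M : Rep k α, M.Sub → ℂ) (h : Rep k β → ℂ)
    (hF : ∀ (A : Rep k β) (M : Rep k α) (f : ∀ i, (Fin (β i) → k) →ₗ[k] (Fin (α i) → k)),
      (∀ i, Function.Injective (f i)) → IsHom A M f → ∀ N : M.Sub,
        (∀ i, N.carrier i = LinearMap.range (f i)) → F M N = h A) :
    (glCard k β : ℂ) * charSum ψ W (fun M : Rep k α => ∑ N : M.Sub with N.dim = β, F M N)
      = (Nat.card (InjFamily k β α) : ℂ)
        * (Fintype.card k : ℂ) ^ (∑ i, ∑ j, ∑ _a : (i ⟶ j), γ i * β j)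
        * (charSum ψ W h * charSum (α := γ) ψ W 1) := by
  -- This sum has at most one term; it is `0` when the image of `f` is not a subrepresentation of
  -- `M`.
  let F' : Rep k α → InjFamily k β α → ℂ := fun M f =>
    ∑ N : M.Sub with ∀ i, N.carrier i = LinearMap.range (f i).1, F M N
  have h1 : ∀ M : Rep k α, (glCard k β : ℂ) * ∑ N : M.Sub with N.dim = β, F M N
      = ∑ f, F' M f := by
    intro M
    simp only [F', Finset.sum_filter]
    rw [Finset.sum_comm, Finset.mul_sum]
    refine Finset.sum_congr rfl fun N _ => ?_
    rw [← Finset.sum_filter, Finset.sum_const, card_injFamily_range_eq]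
    change _ = (if N.dim = β then _ else _) • _
    split_ifs <;> simp
  have h2 : ∀ f : InjFamily k β α, ∑ M : Rep k α, ψ (W.trace M) * F' M f
      = (Fintype.card k : ℂ) ^ (∑ i, ∑ j, ∑ _a : (i ⟶ j), γ i * β j)
        * (charSum ψ W h * charSum (α := γ) ψ W 1) := by
    intro f
    choose φ hφ using fun i => exists_linearEquiv_prod (congrFun hα i) (f i).1 (f i).2
    rw [← Fintype.sum_of_injective (blockRep φ) (blockRep_injective φ)
      (fun x => (ψ (W.trace x.1.1) * h x.1.1) * (ψ (W.trace x.1.2) * 1))]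
    · rw [Fintype.sum_prod_type, Fintype.sum_prod_type, charSum, charSum, Finset.sum_mul_sum,
        Finset.mul_sum]
      refine Finset.sum_congr rfl fun A _ => ?_
      rw [Finset.mul_sum]
      refine Finset.sum_congr rfl fun D _ => ?_
      dsimp only
      rw [Finset.sum_const, Finset.card_univ, card_offDiag, nsmul_eq_mul, Nat.cast_pow]
      rfl
    -- Outside the block triangular representations the image of `f` is not preserved, so the
    -- contribution is zero.
    · intro M hM
      simp only [F']
      rw [Finset.sum_eq_zero, mul_zero]
      intro N hN
      refine (hM (mem_range_blockRep φ fun i j a y => ?_)).elim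
      simp only [Finset.mem_filter, Finset.mem_univ, true_and] at hN
      have hm := N.map_mem i j a (φ i (y, 0)) (by rw [hN, hφ]; exact ⟨y, rfl⟩)
      rw [hN] at hm
      obtain ⟨z, hz⟩ := hm
      rw [← hz, ← hφ, LinearEquiv.symm_apply_apply]
    · intro x
      have hom : IsHom x.1.1 (blockRep φ x) fun i => (f i).1 := by
        intro i j a y
        rw [← hφ, ← hφ, blockRep_apply]
        simp
      let N₀ : (blockRep φ x).Sub :=
        { carrier := fun i => LinearMap.range (f i).1
          map_mem := by
            rintro i j a _ ⟨y, rfl⟩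
            exact ⟨x.1.1 i j a y, hom i j a y⟩ }
      have hN : F' (blockRep φ x) f = h x.1.1 := by
        simp only [F']
        rw [Finset.sum_eq_single_of_mem N₀ (by simp [N₀])]
        · exact hF _ _ _ (fun i => (f i).2) hom N₀ fun i => rfl
        · intro N hN hne
          refine (hne (Rep.Sub.carrier_injective (funext fun i => ?_))).elim
          exact (Finset.mem_filter.1 hN).2 i
      rw [hN, trace_blockRep, AddChar.map_add_eq_mul]
      ring
  calc (glCard k β : ℂ) * charSum ψ W (fun M : Rep k α => ∑ N : M.Sub with N.dim = β, F M N)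
      = ∑ M : Rep k α, ∑ f, ψ (W.trace M) * F' M f := by
        rw [charSum, Finset.mul_sum]
        refine Finset.sum_congr rfl fun M _ => ?_
        rw [mul_left_comm, h1, Finset.mul_sum]
    _ = _ := by
        rw [Finset.sum_comm, Finset.sum_congr rfl fun f _ => h2 f, Finset.sum_const,
          Finset.card_univ, nsmul_eq_mul, Nat.card_eq_fintype_card, mul_assoc]

end Product

/-! ### Sums over tuples -/

section Tuples

variable {V : Type*} [Fintype V]

/-- The tuples of nonzero dimension vectors with sum `δ`, all of whose proper nonempty partial sums
have a positive value under `L`. -/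
def positiveTuples (L : (V → ℕ) → ℝ) (δ : V → ℕ) : Set (Σ m : ℕ, Fin m → (V → ℕ)) :=
  {t | (∀ i, t.2 i ≠ 0) ∧ ∑ i, t.2 i = δ ∧ ∀ j : ℕ, 1 ≤ j → j < t.1 →
    0 < L (∑ i ∈ Finset.univ.filter (fun i : Fin t.1 => i.val < j), t.2 i)}

theorem positiveTuples_finite (L : (V → ℕ) → ℝ) (δ : V → ℕ) : (positiveTuples L δ).Finite := by
  have key : (⋃ m ∈ Set.Iic (∑ v, δ v),
      (fun t => (⟨m, t⟩ : Σ m : ℕ, Fin m → (V → ℕ))) ''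
        (Set.pi Set.univ fun _ => Set.Iic δ)).Finite :=
    (Set.finite_Iic _).biUnion fun m _ =>
      Set.Finite.image _ (Set.Finite.pi fun _ => Set.finite_Iic δ)
  refine key.subset ?_
  rintro ⟨m, t⟩ ⟨h0, hs, _⟩
  simp only at h0 hs
  simp only [Set.mem_iUnion]
  refine ⟨m, ?_, t, fun i _ => ?_, rfl⟩
  · have h1 : ∀ i : Fin m, 1 ≤ ∑ v, t i v := fun i => by
      obtain ⟨v, hv⟩ := Function.ne_iff.1 (h0 i)
      exact (Nat.one_le_iff_ne_zero.2 hv).trans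
        (Finset.single_le_sum (f := t i) (fun _ _ => Nat.zero_le _) (Finset.mem_univ v))
    calc m = ∑ _i : Fin m, 1 := by simp
      _ ≤ ∑ i, ∑ v, t i v := Finset.sum_le_sum fun i _ => h1 i
      _ = ∑ v, δ v := by
        rw [Finset.sum_comm, ← hs]
        simp [Finset.sum_apply]
  · rw [Set.mem_Iic, ← hs]
    exact Finset.single_le_sum (f := t) (fun _ _ => zero_le) (Finset.mem_univ i)

/-- The finite set of the tuples in `positiveTuples`. -/
def positiveTupleFinset (L : (V → ℕ) → ℝ) (δ : V → ℕ) : Finset (Σ m : ℕ, Fin m → (V → ℕ)) :=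
  (positiveTuples_finite L δ).toFinset

theorem mem_positiveTupleFinset {L : (V → ℕ) → ℝ} {δ : V → ℕ} {t : Σ m : ℕ, Fin m → (V → ℕ)} :
    t ∈ positiveTupleFinset L δ ↔ t ∈ positiveTuples L δ :=
  Set.Finite.mem_toFinset _

theorem partialSum_snoc {V : Type*} {n : ℕ} (t : Fin n → (V → ℕ)) (γ : V → ℕ) {j : ℕ} (hj : j ≤ n) :
    ∑ i ∈ Finset.univ.filter (fun i : Fin (n + 1) => i.val < j), Fin.snoc (α := fun _ => V → ℕ) t γ i
      = ∑ i ∈ Finset.univ.filter (fun i : Fin n => i.val < j), t i := by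
  rw [Finset.sum_filter, Finset.sum_filter, Fin.sum_univ_castSucc]
  simp [hj.not_gt]

theorem sum_filter_val_lt {V : Type*} {n : ℕ} (t : Fin n → (V → ℕ)) :
    ∑ i ∈ Finset.univ.filter (fun i : Fin n => i.val < n), t i = ∑ i, t i := by
  simp

theorem eq_zero_of_mem_positiveTuples {V : Type*} {L : (V → ℕ) → ℝ} {t : Σ m : ℕ, Fin m → (V → ℕ)}
    (ht : t ∈ positiveTuples L 0) : t.1 = 0 := by
  obtain ⟨n, t⟩ := t
  rcases n with - | n
  · rfl
  · have h := Finset.sum_eq_zero_iff.1 ht.2.1 0 (Finset.mem_univ _)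
    exact (ht.1 0 h).elim

theorem positiveTuples_zero (L : (V → ℕ) → ℝ) :
    positiveTupleFinset L (0 : V → ℕ) = {⟨0, Fin.elim0⟩} := by
  ext t
  rw [mem_positiveTupleFinset, Finset.mem_singleton]
  constructor
  · intro ht
    have h := eq_zero_of_mem_positiveTuples ht
    obtain ⟨n, t⟩ := t
    obtain rfl : n = 0 := h
    congr
    exact Subsingleton.elim _ _
  · rintro rfl
    exact ⟨fun i => i.elim0, by simp, fun j _ h => absurd h (Nat.not_lt_zero j)⟩

/-- Appending an entry turns the old total into a proper partial sum, which must be positive unless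
the old tuple was empty. The new total is not subject to positivity. -/
theorem snoc_mem_positiveTuples_iff {V : Type*} {L : (V → ℕ) → ℝ} {δ γ : V → ℕ} {n : ℕ}
    {t : Fin n → (V → ℕ)} (hγ : γ ≠ 0) (hδ : ∑ i, t i + γ = δ) :
    (⟨n + 1, Fin.snoc (α := fun _ => V → ℕ) t γ⟩ : Σ m : ℕ, Fin m → (V → ℕ)) ∈ positiveTuples L δ ↔
      (⟨n, t⟩ : Σ m : ℕ, Fin m → (V → ℕ)) ∈ positiveTuples L (∑ i, t i) ∧
        (∑ i, t i = 0 ∨ 0 < L (∑ i, t i)) := by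
  constructor
  · rintro ⟨h0, -, h2⟩
    have ht : ∀ i, t i ≠ 0 := fun i => by simpa using h0 i.castSucc
    refine ⟨⟨ht, rfl, fun j hj hjn => ?_⟩, ?_⟩
    · have h := h2 j hj (Nat.lt_succ_of_lt hjn)
      simp only at h
      rwa [partialSum_snoc t γ (le_of_lt hjn)] at h
    · rcases n with - | n
      · simp
      · right
        have h := h2 (n + 1) (Nat.succ_pos n) (Nat.lt_succ_self _)
        simp only at h
        rwa [partialSum_snoc t γ le_rfl, sum_filter_val_lt] at h
  · rintro ⟨h, hL⟩
    refine ⟨fun i => ?_, ?_, fun j hj hjn => ?_⟩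
    · refine Fin.lastCases ?_ (fun i => ?_) i
      · simpa using hγ
      · simpa using h.1 i
    · simp only [Fin.sum_univ_castSucc, Fin.snoc_castSucc, Fin.snoc_last]
      exact hδ
    · simp only at hjn ⊢
      rw [partialSum_snoc t γ (Nat.lt_succ_iff.1 hjn)]
      rcases (Nat.lt_succ_iff.1 hjn).lt_or_eq with hlt | rfl
      · exact h.2.2 j hj hlt
      · rw [sum_filter_val_lt]
        -- A zero total forces the empty tuple, which has no partial sum with `1 ≤ j` to test.
        refine hL.resolve_left fun hz => ?_
        have h' := h
        rw [hz] at h'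
        have := eq_zero_of_mem_positiveTuples h'
        simp only at this
        omega

/-- Splits off the last entry `δ - β`, where `β` is the sum of the preceding entries. -/
theorem sum_positiveTuples {L : (V → ℕ) → ℝ} {δ : V → ℕ} (hδ : δ ≠ 0)
    (f : (Σ m : ℕ, Fin m → (V → ℕ)) → ℂ) :
    ∑ t ∈ positiveTupleFinset L δ, f t
      = ∑ β ∈ Finset.Iio δ with β = 0 ∨ 0 < L β, ∑ t ∈ positiveTupleFinset L β,
          f ⟨t.1 + 1, Fin.snoc (α := fun _ => V → ℕ) t.2 (δ - β)⟩ := by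
  rw [Finset.sum_sigma']
  symm
  refine Finset.sum_bij
    (fun x _ => ⟨x.2.1 + 1, Fin.snoc (α := fun _ => V → ℕ) x.2.2 (δ - x.1)⟩) ?_ ?_ ?_ ?_
  · rintro ⟨β, n, t⟩ hx
    simp only [Finset.mem_sigma, Finset.mem_filter, Finset.mem_Iio, mem_positiveTupleFinset] at hx ⊢
    obtain ⟨⟨hβ, hL⟩, ht⟩ := hx
    obtain rfl : ∑ i, t i = β := ht.2.1
    exact (snoc_mem_positiveTuples_iff (fun h => hβ.not_ge (tsub_eq_zero_iff_le.1 h))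
      (add_tsub_cancel_of_le hβ.le)).2 ⟨ht, hL⟩
  · rintro ⟨β, n, t⟩ hx ⟨β', n', t'⟩ hx' h
    simp only [Finset.mem_sigma, Finset.mem_filter, mem_positiveTupleFinset] at hx hx'
    obtain rfl : ∑ i, t i = β := hx.2.2.1
    obtain rfl : ∑ i, t' i = β' := hx'.2.2.1
    simp only [Sigma.mk.injEq, add_left_inj] at h
    obtain ⟨rfl, h⟩ := h
    obtain ⟨rfl, -⟩ := Fin.snoc_injective2 (eq_of_heq h)
    rfl
  · rintro ⟨n, t⟩ ht
    rw [mem_positiveTupleFinset] at ht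
    rcases n with - | n
    · exact (hδ (by simpa using ht.2.1.symm)).elim
    · rw [← Fin.snoc_init_self t] at ht
      have hlast : t (Fin.last n) ≠ 0 := by simpa using ht.1 (Fin.last n)
      have hsum : ∑ i, Fin.init t i + t (Fin.last n) = δ := by
        have := ht.2.1
        simpa [Fin.sum_univ_castSucc, Fin.init] using this
      have h := (snoc_mem_positiveTuples_iff hlast hsum).1 ht
      have hlt : ∑ i, Fin.init t i < δ := by
        rw [← hsum]
        exact lt_add_of_pos_right _ (pos_iff_ne_zero.2 hlast)
      refine ⟨⟨∑ i, Fin.init t i, n, Fin.init t⟩, ?_, ?_⟩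
      · simp only [Finset.mem_sigma, Finset.mem_filter, Finset.mem_Iio, mem_positiveTupleFinset]
        exact ⟨⟨hlt, h.2⟩, h.1⟩
      · have : δ - ∑ i, Fin.init t i = t (Fin.last n) := by
          rw [← hsum, add_tsub_cancel_left]
        simp only [this, Fin.snoc_init_self]
  · intro x _
    rfl

/-- The summand of the formula belonging to a tuple. -/
def tupleTerm (s : ℂ) (B : (V → ℕ) → (V → ℕ) → ℤ) (a : (V → ℕ) → ℂ)
    (t : Σ m : ℕ, Fin m → (V → ℕ)) : ℂ :=
  (-1) ^ t.1 * s ^ (∑ i, ∑ j ∈ Finset.Ioi i, B (t.2 i) (t.2 j)) * ∏ i, a (t.2 i)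

/-- The new pairs are those of an old entry with `γ`; by additivity of `B` in its first argument
they add up to `B` of the old total with `γ`. -/
theorem tupleTerm_snoc {V : Type*} {s : ℂ} (hs : s ≠ 0) {B : (V → ℕ) → (V → ℕ) → ℤ}
    (hB : ∀ (n : ℕ) (t : Fin n → (V → ℕ)) γ, B (∑ i, t i) γ = ∑ i, B (t i) γ)
    (a : (V → ℕ) → ℂ) (t : Σ m : ℕ, Fin m → (V → ℕ)) (γ : V → ℕ) :
    tupleTerm s B a ⟨t.1 + 1, Fin.snoc (α := fun _ => V → ℕ) t.2 γ⟩
      = -(tupleTerm s B a t * (s ^ B (∑ i, t.2 i) γ * a γ)) := by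
  have h1 : ∀ (n : ℕ) (u : Fin n → (V → ℕ)), ∑ i, ∑ j ∈ Finset.Ioi i, B (u i) (u j)
      = ∑ i, ∑ j, if i < j then B (u i) (u j) else 0 := by
    intro n u
    refine Finset.sum_congr rfl fun i _ => ?_
    rw [← Finset.sum_filter]
    congr 1
    ext j
    simp
  have h2 : ∑ i, ∑ j ∈ Finset.Ioi i, B (Fin.snoc (α := fun _ => V → ℕ) t.2 γ i)
      (Fin.snoc (α := fun _ => V → ℕ) t.2 γ j)
      = ∑ i, ∑ j ∈ Finset.Ioi i, B (t.2 i) (t.2 j) + B (∑ i, t.2 i) γ := by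
    rw [h1, h1, hB]
    simp only [Fin.sum_univ_castSucc, Fin.snoc_castSucc, Fin.snoc_last, Fin.castSucc_lt_castSucc_iff,
      Fin.castSucc_lt_last, if_true, Finset.sum_add_distrib, lt_irrefl, if_false,
      (Fin.castSucc_lt_last _).not_gt, Finset.sum_const_zero, add_zero]
  unfold tupleTerm
  simp only [h2]
  rw [zpow_add₀ hs, pow_succ, Fin.prod_univ_castSucc]
  simp only [Fin.snoc_castSucc, Fin.snoc_last]
  ring

/-- Unrolls the recursion for `Φ`. Positivity of `L δ` is not needed in the conclusion, since it
restricts proper partial sums only; this permits the use at `δ = α`, where the excess is zero and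
`Φ` itself vanishes. -/
theorem sum_tupleTerm {L : (V → ℕ) → ℝ} {s : ℂ} (hs : s ≠ 0) {B : (V → ℕ) → (V → ℕ) → ℤ}
    (hB : ∀ (n : ℕ) (t : Fin n → (V → ℕ)) γ, B (∑ i, t i) γ = ∑ i, B (t i) γ)
    (a Φ : (V → ℕ) → ℂ) (hΦ0 : Φ 0 = 1)
    (hΦ : ∀ δ, δ ≠ 0 → Φ δ =
      if 0 < L δ then -∑ β ∈ Finset.Iio δ, s ^ B β (δ - β) * (Φ β * a (δ - β)) else 0)
    {δ : V → ℕ} (hδ : δ ≠ 0) :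
    ∑ t ∈ positiveTupleFinset L δ, tupleTerm s B a t
      = -∑ β ∈ Finset.Iio δ, s ^ B β (δ - β) * (Φ β * a (δ - β)) := by
  induction δ using WellFoundedLT.induction with
  | ind δ ih =>
    have hR : ∀ β < δ, (β = 0 ∨ 0 < L β) →
        ∑ t ∈ positiveTupleFinset L β, tupleTerm s B a t = Φ β := by
      intro β hβ h
      by_cases h0 : β = 0
      · rw [h0, positiveTuples_zero, Finset.sum_singleton, hΦ0]
        simp [tupleTerm]
      · rw [ih β hβ h0, hΦ β h0, if_pos (h.resolve_left h0)]
    rw [sum_positiveTuples hδ, Finset.sum_filter, ← Finset.sum_neg_distrib]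
    refine Finset.sum_congr rfl fun β hβ => ?_
    split_ifs with h
    · rw [← hR β (Finset.mem_Iio.1 hβ) h, Finset.sum_mul, Finset.mul_sum, ← Finset.sum_neg_distrib]
      refine Finset.sum_congr rfl fun t ht => ?_
      rw [tupleTerm_snoc hs hB, (mem_positiveTupleFinset.1 ht).2.1]
      ring
    · rw [not_or] at h
      rw [hΦ β h.1, if_neg h.2]
      simp

theorem tupleFinset_eq (θ : V → ℝ) {α : V → ℕ} (hα : α ≠ 0) :
    tupleFinset θ α = positiveTupleFinset (excess θ α) α := by
  ext ⟨n, t⟩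
  rw [mem_positiveTupleFinset, tupleFinset, Set.Finite.mem_toFinset]
  have key : ∀ j, 1 ≤ j → j < n → (∀ i, t i ≠ 0) →
      (0 < excess θ α (∑ i ∈ Finset.univ.filter (fun i : Fin n => i.val < j), t i) ↔
        slope θ α < slope θ (∑ i ∈ Finset.univ.filter (fun i : Fin n => i.val < j), t i)) := by
    intro j hj hjn h0
    refine excess_pos_iff θ α fun hz => h0 ⟨0, by omega⟩ ?_
    exact Finset.sum_eq_zero_iff.1 hz _ (by simp; omega)
  constructor
  · rintro ⟨-, h0, hs, h⟩
    exact ⟨h0, hs, fun j hj hjn => (key j hj hjn h0).2 (h j hj hjn)⟩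
  · rintro ⟨h0, hs, h⟩
    refine ⟨Nat.one_le_iff_ne_zero.2 ?_, h0, hs, fun j hj hjn => (key j hj hjn h0).1 (h j hj hjn)⟩
    rintro rfl
    exact hα (by simpa using hs.symm)

end Tuples

/-! ### The wall-crossing formula -/

section Forms

variable {V : Type*} [Quiver V] [Fintype V] [∀ i j : V, Fintype (i ⟶ j)]

theorem toInt_add {V : Type*} (α β : V → ℕ) : toInt (α + β) = toInt α + toInt β := by
  funext i
  simp [toInt]

theorem eulerForm_add_left (x y z : V → ℤ) :
    eulerForm (x + y) z = eulerForm x z + eulerForm y z := by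
  simp only [eulerForm, Pi.add_apply, add_mul, Finset.sum_add_distrib]
  ring

theorem eulerForm_add_right (x y z : V → ℤ) :
    eulerForm x (y + z) = eulerForm x y + eulerForm x z := by
  simp only [eulerForm, Pi.add_apply, mul_add, Finset.sum_add_distrib]
  ring

theorem skewForm_toInt_sum (n : ℕ) (t : Fin n → (V → ℕ)) (γ : V → ℕ) :
    skewForm (toInt (∑ i, t i)) (toInt γ) = ∑ i, skewForm (toInt (t i)) (toInt γ) :=
  map_sum (AddMonoidHom.mk' (fun β : V → ℕ => skewForm (toInt β) (toInt γ)) fun x y => by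
    simp only [skewForm, toInt_add, eulerForm_add_left, eulerForm_add_right]
    ring) t Finset.univ

/-- The difference between the symmetrised form and the skew form is `2 χ(γ, β)`. Its two parts are
kept on opposite sides as natural numbers, so that they become ordinary powers of `q` after
exponentiating `-q^{1/2}`. -/
theorem titsForm_toInt_add (β γ : V → ℕ) :
    titsForm (toInt (β + γ)) + 2 * ((∑ i, ∑ j, ∑ _a : (i ⟶ j), γ i * β j : ℕ) : ℤ)
      = skewForm (toInt β) (toInt γ) + titsForm (toInt β) + titsForm (toInt γ)
        + 2 * ((∑ i, β i * γ i : ℕ) : ℤ) := by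
  have h : eulerForm (toInt γ) (toInt β) = ((∑ i, β i * γ i : ℕ) : ℤ)
      - ((∑ i, ∑ j, ∑ _a : (i ⟶ j), γ i * β j : ℕ) : ℤ) := by
    unfold eulerForm toInt
    push_cast
    congr 1
    exact Finset.sum_congr rfl fun i _ => mul_comm _ _
  simp only [titsForm, skewForm, toInt_add, eulerForm_add_left, eulerForm_add_right]
  rw [h]
  ring

end Forms

/-! ### Chain integrals, their recursion, and the resolved formula -/

section WallCrossing

variable {V : Type*} [Quiver V] [Fintype V] [∀ i j : V, Fintype (i ⟶ j)]
  {k : Type*} [Field k] [Fintype k]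

theorem negSqrt_sq (k : Type*) [Fintype k] : (negSqrt k : ℂ) ^ 2 = Fintype.card k := by
  rw [← Complex.ofReal_pow, negSqrt, neg_sq, Real.sq_sqrt (Nat.cast_nonneg _),
    Complex.ofReal_natCast]

theorem negSqrt_ne_zero (k : Type*) [Fintype k] [Nonempty k] : (negSqrt k : ℂ) ≠ 0 := by
  intro h
  have := negSqrt_sq k
  rw [h, zero_pow two_ne_zero] at this
  exact Nat.cast_ne_zero.2 Fintype.card_ne_zero this.symm

/-- Bookkeeping of the constants in `sum_sub_charSum`: the orders of the linear groups and the
number of off-diagonal blocks combine with the Tits forms to leave exactly the skew form as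
exponent. -/
theorem normFactor_add (β γ : V → ℕ) :
    normFactor k (β + γ) * ((Nat.card (InjFamily k β (β + γ)) : ℂ)
        * (Fintype.card k : ℂ) ^ (∑ i, ∑ j, ∑ _a : (i ⟶ j), γ i * β j))
      = (negSqrt k : ℂ) ^ skewForm (toInt β) (toInt γ)
        * (normFactor k β * glCard k β) * normFactor k γ := by
  have hs := negSqrt_ne_zero k
  have hβ : (glCard k β : ℂ) ≠ 0 := Nat.cast_ne_zero.2 glCard_pos.ne'
  have hγ : (glCard k γ : ℂ) ≠ 0 := Nat.cast_ne_zero.2 glCard_pos.ne'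
  have hα : (glCard k (β + γ) : ℂ) ≠ 0 := Nat.cast_ne_zero.2 glCard_pos.ne'
  have hcard : (glCard k (β + γ) : ℂ) = Nat.card (InjFamily k β (β + γ))
      * (Fintype.card k : ℂ) ^ (∑ i, β i * γ i) * glCard k γ := by
    rw [glCard_add]
    push_cast
    rfl
  have hpow := congrArg (fun n : ℤ => (negSqrt k : ℂ) ^ n) (titsForm_toInt_add β γ)
  simp only [zpow_add₀ hs, zpow_mul, zpow_natCast, zpow_ofNat, negSqrt_sq] at hpow
  unfold normFactor
  rw [div_mul_cancel₀ _ hβ, div_mul_eq_mul_div, mul_div_assoc', div_eq_div_iff hα hγ, hcard]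
  linear_combination (Nat.card (InjFamily k β (β + γ)) * glCard k γ : ℂ) * hpow

theorem normFactor_mul_charSum_sub (ψ : AddChar k ℂ) (W : Potential V k) {α β γ : V → ℕ}
    (hα : β + γ = α) (F : ∀ M : Rep k α, M.Sub → ℂ) (h : Rep k β → ℂ)
    (hF : ∀ (A : Rep k β) (M : Rep k α) (f : ∀ i, (Fin (β i) → k) →ₗ[k] (Fin (α i) → k)),
      (∀ i, Function.Injective (f i)) → IsHom A M f → ∀ N : M.Sub,
        (∀ i, N.carrier i = LinearMap.range (f i)) → F M N = h A) :
    normFactor k α * charSum ψ W (fun M : Rep k α => ∑ N : M.Sub with N.dim = β, F M N)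
      = (negSqrt k : ℂ) ^ skewForm (toInt β) (toInt γ)
        * ((normFactor k β * charSum ψ W h) * (normFactor k γ * charSum (α := γ) ψ W 1)) := by
  have hβ : (glCard k β : ℂ) ≠ 0 := Nat.cast_ne_zero.2 glCard_pos.ne'
  have h1 := sum_sub_charSum ψ W hα F h hF
  subst hα
  apply mul_left_cancel₀ hβ
  rw [mul_left_comm, h1, ← mul_assoc, normFactor_add]
  ring

/-- The integral of the signed count of chains of subrepresentations which are positive for
`excess θ α`. -/
def chainIntegral (ψ : AddChar k ℂ) (W : Potential V k) (θ : V → ℝ) (α β : V → ℕ) : ℂ :=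
  normFactor k β * charSum ψ W fun M : Rep k β =>
    (mob (fun N : M.Sub => 0 < excess θ α N.dim) ⊤ : ℂ)

/-- Sort the proper subrepresentations by dimension vector `β` and factor each part: the
subrepresentation yields a chain integral, the quotient an unrestricted character sum. -/
theorem normFactor_mul_charSum_mob (ψ : AddChar k ℂ) (W : Potential V k) (θ : V → ℝ)
    (α δ : V → ℕ) :
    normFactor k δ * charSum ψ W (fun M : Rep k δ => ∑ N : M.Sub with N.dim ≠ δ,
        (mob (fun N : M.Sub => 0 < excess θ α N.dim) N : ℂ))
      = ∑ β ∈ Finset.Iio δ, (negSqrt k : ℂ) ^ skewForm (toInt β) (toInt (δ - β))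
        * (chainIntegral ψ W θ α β
          * (normFactor k (δ - β) * charSum (α := δ - β) ψ W 1)) := by
  have h1 : ∀ M : Rep k δ, ∑ N : M.Sub with N.dim ≠ δ,
        (mob (fun N : M.Sub => 0 < excess θ α N.dim) N : ℂ)
      = ∑ β ∈ Finset.Iio δ, ∑ N : M.Sub with N.dim = β,
        (mob (fun N : M.Sub => 0 < excess θ α N.dim) N : ℂ) := by
    intro M
    rw [← Finset.sum_fiberwise_of_maps_to (t := Finset.Iio δ) (g := fun N : M.Sub => N.dim)]
    · refine Finset.sum_congr rfl fun β hβ => Finset.sum_congr ?_ fun _ _ => rfl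
      ext N
      simp only [Finset.mem_filter, Finset.mem_univ, true_and, and_iff_right_iff_imp]
      rintro rfl
      exact (Finset.mem_Iio.1 hβ).ne
    · intro N hN
      exact Finset.mem_Iio.2 (lt_of_le_of_ne N.dim_le (Finset.mem_filter.1 hN).2)
  simp only [h1]
  have h2 : ∀ f : (V → ℕ) → Rep k δ → ℂ, charSum ψ W (fun M => ∑ β ∈ Finset.Iio δ, f β M)
      = ∑ β ∈ Finset.Iio δ, charSum ψ W (f β) := by
    intro f
    simp only [charSum, Finset.mul_sum]
    exact Finset.sum_comm
  rw [h2, Finset.mul_sum]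
  refine Finset.sum_congr rfl fun β hβ => ?_
  refine normFactor_mul_charSum_sub ψ W (add_tsub_cancel_of_le (Finset.mem_Iio.1 hβ).le) _ _ ?_
  intro A M f hinj hom N hN
  rw [mob_subEmbedding (fun β => 0 < excess θ α β) hom hinj N hN]

theorem chainIntegral_zero (ψ : AddChar k ℂ) (W : Potential V k) (θ : V → ℝ) (α : V → ℕ) :
    chainIntegral ψ W θ α 0 = 1 := by
  have hgl : glCard k (0 : V → ℕ) = 1 := by
    rw [glCard, Nat.card_pi]
    refine Finset.prod_eq_one fun i _ => ?_
    rw [card_linearEquiv_eq, Pi.zero_apply, card_injective_linearMap le_rfl]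
    rfl
  have htits : titsForm (toInt (0 : V → ℕ)) = 0 := by
    simp [titsForm, eulerForm, toInt]
  have hM : ∀ M : Rep k (0 : V → ℕ), W.trace M = 0 := by
    intro M
    refine Finset.sum_eq_zero fun u _ => ?_
    have : M.pathMap u.path = 0 := LinearMap.ext fun x => funext fun i => i.elim0
    simp [this]
  have hmob : ∀ M : Rep k (0 : V → ℕ),
      mob (fun N : M.Sub => 0 < excess θ α N.dim) ⊤ = 1 := by
    intro M
    have : (⊤ : M.Sub) = ⊥ := Rep.Sub.dim_eq_zero_iff.1 (Rep.Sub.dim_top M)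
    rw [this, mob_bot]
  have huniq : Fintype.card (Rep k (0 : V → ℕ)) = 1 := by
    refine Fintype.card_eq_one_iff.2 ⟨0, fun M => ?_⟩
    funext i j a
    exact LinearMap.ext fun x => funext fun l => l.elim0
  simp only [chainIntegral, charSum, hM, hmob, normFactor, hgl, htits, AddChar.map_zero_eq_one]
  simp [huniq]

/-- The defining recursion of `mob` at the top element, integrated over the representation space. -/
theorem chainIntegral_of_ne_zero (ψ : AddChar k ℂ) (W : Potential V k) (θ : V → ℝ)
    (α : V → ℕ) {δ : V → ℕ} (hδ : δ ≠ 0) :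
    chainIntegral ψ W θ α δ = if 0 < excess θ α δ then
      -∑ β ∈ Finset.Iio δ, (negSqrt k : ℂ) ^ skewForm (toInt β) (toInt (δ - β))
        * (chainIntegral ψ W θ α β
          * (normFactor k (δ - β) * charSum (α := δ - β) ψ W 1)) else 0 := by
  have htop : ∀ M : Rep k δ, (⊤ : M.Sub) ≠ ⊥ := fun M h => hδ (by
    have := Rep.Sub.dim_bot M
    rwa [← h, Rep.Sub.dim_top] at this)
  split_ifs with h
  · rw [← normFactor_mul_charSum_mob, chainIntegral, ← mul_neg, charSum, charSum,
      ← Finset.sum_neg_distrib]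
    congr 1
    refine Finset.sum_congr rfl fun M _ => ?_
    rw [mob_of_pos (htop M) (by rwa [Rep.Sub.dim_top]), ← mul_neg]
    push_cast
    congr 2
    refine Finset.sum_congr (Finset.ext fun N => ?_) fun _ _ => rfl
    simp [lt_top_iff_ne_top, Rep.Sub.dim_eq_iff]
  · have : ∀ M : Rep k δ, mob (fun N : M.Sub => 0 < excess θ α N.dim) ⊤ = 0 := fun M =>
      mob_of_not (htop M) (by rwa [Rep.Sub.dim_top])
    simp [chainIntegral, charSum, this]

theorem exists_primitive_addChar (k : Type*) [Field k] [Fintype k] :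
    ∃ ψ : AddChar k ℂ, ψ.IsPrimitive := by
  obtain ⟨ψ, hψ⟩ := AddChar.exists_apply_ne_zero.2 (one_ne_zero (α := k))
  refine ⟨ψ, AddChar.IsPrimitive.of_ne_one fun h => hψ ?_⟩
  rw [h, AddChar.one_apply]

theorem dtInvariant_eq_sum_tuples {W : Potential V k} (hW : W.IsPrimitive) (θ : V → ℝ)
    {α : V → ℕ} (hα : α ≠ 0) :
    (dtInvariant W θ α : ℂ) = -∑ t ∈ tupleFinset θ α,
      tupleTerm (negSqrt k : ℂ) (fun β γ => skewForm (toInt β) (toInt γ))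
        (fun γ => (dtInvariant W 0 γ : ℂ)) t := by
  obtain ⟨ψ, hψ⟩ := exists_primitive_addChar k
  have hA : (fun γ => (dtInvariant W 0 γ : ℂ))
      = fun γ => normFactor k γ * charSum (α := γ) ψ W 1 :=
    funext fun γ => dtInvariant_zero_eq hW hψ γ
  have hsum := sum_tupleTerm (L := excess θ α) (negSqrt_ne_zero k)
    (B := fun β γ => skewForm (toInt β) (toInt γ)) skewForm_toInt_sum
    (fun γ => normFactor k γ * charSum (α := γ) ψ W 1)
    (chainIntegral ψ W θ α) (chainIntegral_zero ψ W θ α)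
    (fun δ hδ => chainIntegral_of_ne_zero ψ W θ α hδ) hα
  rw [hA, tupleFinset_eq θ hα, hsum, neg_neg, dtInvariant_eq hW hψ]
  -- With `δ = α` the integrand is the signed count over proper subrepresentations, which is the
  -- indicator of semistability.
  refine Eq.trans ?_ (normFactor_mul_charSum_mob ψ W θ α α)
  congr 2
  funext M
  have h := congrArg (Int.cast : ℤ → ℂ) (sum_mob_lt_top θ hα M)
  push_cast at h
  exact h.symm

end WallCrossing

end

end QuiverDT

theorem mainTheorem5 {V : Type*} [Quiver V] [Fintype V] [∀ i j : V, Fintype (i ⟶ j)]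
    {k : Type*} [Field k] [Fintype k]
    (W : QuiverDT.Potential V k)
    (wt : ∀ i j : V, (i ⟶ j) → ℕ)
    (hwt_pos : ∀ u : QuiverDT.CyclePath V, 0 < u.weight wt)
    (hwt_hom : W.IsHomogeneous wt)
    (hW : W.IsPrimitive)
    (θ : V → ℝ) (α : V → ℕ) (hα : α ≠ 0) :
    QuiverDT.dtInvariant W θ α =
      ∑ t ∈ QuiverDT.tupleFinset θ α,
        (-1 : ℝ) ^ (t.1 - 1) *
          (-Real.sqrt (Fintype.card k : ℝ)) ^
            (∑ i : Fin t.1, ∑ j ∈ Finset.Ioi i,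
              QuiverDT.skewForm (QuiverDT.toInt (t.2 i)) (QuiverDT.toInt (t.2 j))) *
          ∏ i : Fin t.1, QuiverDT.dtInvariant W (0 : V → ℝ) (t.2 i) := by
  -- The invariants are real, but the characters expressing them take complex values.
  apply Complex.ofReal_injective
  rw [QuiverDT.dtInvariant_eq_sum_tuples hW θ hα, ← Finset.sum_neg_distrib]
  push_cast
  refine Finset.sum_congr rfl fun t ht => ?_
  have ht1 : 1 ≤ t.1 := ((Set.Finite.mem_toFinset _).1 ht).1
  obtain ⟨n, hn⟩ := Nat.exists_eq_add_of_le' ht1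
  -- The truncated subtraction is harmless because the tuples are nonempty; the sign absorbs the
  -- outer minus of `dtInvariant_eq_sum_tuples`.
  have hsign : (-1 : ℂ) ^ (t.1 - 1) = -(-1) ^ t.1 := by
    rw [hn, Nat.add_sub_cancel, pow_succ]
    ring
  rw [hsign, QuiverDT.tupleTerm, QuiverDT.negSqrt]
  push_cast
  ring
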